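/- Let $d\ge 5$. For $\lambda>0$ with $\lambda^2\in\mathbb N$ and $f:\mathbb Z^d\to\mathbb C$ put $$A_\lambda f(n)=\frac1{N_\lambda}\sum_{m\in\mathbb Z^d,\ |m|=\lambda}f(n-m),\qquad N_\lambda=\#\{m\in\mathbb Z^d:|m|=\lambda\},$$ where $|\cdot|$ is the Euclidean norm. For $f\in\ell^2(\mathbb Z^d)$ let $\widehat f(\alpha)=\sum_{n\in\mathbb Z^d}f(n)e^{-2\pi i n\cdot\alpha}$ be its Fourier transform (the series converging in $L^2(\mathbb T^d)$, $\mathbb T=\mathbb R/\mathbb Z$). For integers $j,k\ge 0$ let $q_j=\operatorname{lcm}\{1,2,\dots,2^j\}$ and let $$\Omega_{j,k}=\{\alpha\in\mathbb T^d:\ \alpha\in[-2^{j-k},2^{j-k}]^d+(q_j^{-1}\mathbb Z)^d\}.$$ Then there is a constant $C>0$ depending only on $d$ such that for all $k,j\in\mathbb N$ with $1\le j\le\log_2 k-2$ and all $f\in\ell^2(\mathbb Z^d)$ whose Fourier transform is supported in the complement of $\Omega_{j,k}$ (that is, $\widehat f=0$ almost everywhere on $\Omega_{j,k}$), $$\Bigl\|\sup_{2^k\le\lambda\le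 2^{k+1},\ \lambda^2\in\mathbb N}|A_\lambda f|\Bigr\|_{\ell^2(\mathbb Z^d)}\le C\,2^{-j/2}j^{-1}\,\|f\|_{\ell^2(\mathbb Z^d)}.$$ -/

import Mathlib

open MeasureTheory
open scoped ENNReal

noncomputable section

namespace DiscreteSpherical

/-- The discrete sphere `{m ∈ ℤ^d : |m| = lam}`, with `|m|` the Euclidean norm. -/
def sphereSet (d : ℕ) (lam : ℝ) : Set (Fin d → ℤ) :=
  {m | Real.sqrt (∑ i, (m i : ℝ) ^ 2) = lam}

theorem sphereSet_finite (d : ℕ) (lam : ℝ) : (sphereSet d lam).Finite := by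
  refine (Set.finite_Icc (fun _ : Fin d => -⌈lam⌉) (fun _ => ⌈lam⌉)).subset ?_
  intro m hm
  have key : ∀ i, |(m i : ℝ)| ≤ lam := by
    intro i
    have h : Real.sqrt (∑ i, (m i : ℝ) ^ 2) = lam := hm
    rw [← h]
    refine Real.abs_le_sqrt ?_
    exact Finset.single_le_sum (f := fun i => (m i : ℝ) ^ 2) (fun _ _ => sq_nonneg _)
      (Finset.mem_univ i)
  have key' : ∀ i, |m i| ≤ ⌈lam⌉ := by
    intro i
    have h := (key i).trans (Int.le_ceil lam)
    exact_mod_cast h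
  exact ⟨fun i => (abs_le.mp (key' i)).1, fun i => (abs_le.mp (key' i)).2⟩

/-- The discrete sphere of radius `lam` as a finite set; its cardinality is `N_lam`. -/
def sphere (d : ℕ) (lam : ℝ) : Finset (Fin d → ℤ) := (sphereSet_finite d lam).toFinset

/-- The spherical average `A_lam f (n) = N_lam⁻¹ ∑_{|m| = lam} f (n - m)`. -/
def sphericalAverage {d : ℕ} (lam : ℝ) (f : (Fin d → ℤ) → ℂ) (n : Fin d → ℤ) : ℂ :=
  ((sphere d lam).card : ℂ)⁻¹ * ∑ m ∈ sphere d lam, f (n - m)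

/-- The radii of the dyadic scale `k`: `2^k ≤ lam ≤ 2^(k+1)` with `lam^2` a natural number. -/
def dyadicRadii (k : ℕ) : Set ℝ :=
  {lam | 2 ^ k ≤ lam ∧ lam ≤ 2 ^ (k + 1) ∧ ∃ N : ℕ, lam ^ 2 = N}

/-- The maximal function at the dyadic scale `k`, `sup |A_lam f|` over the radii above. -/
def dyadicMaximal {d : ℕ} (k : ℕ) (f : (Fin d → ℤ) → ℂ) (n : Fin d → ℤ) : ℝ≥0∞ :=
  ⨆ lam ∈ dyadicRadii k, ‖sphericalAverage lam f n‖ₑ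

/-- The `ℓ²(ℤ^d)` norm of a function with values in `[0, ∞]`. -/
def l2Norm {d : ℕ} (g : (Fin d → ℤ) → ℝ≥0∞) : ℝ≥0∞ := (∑' n, g n ^ 2) ^ (1 / 2 : ℝ)

/-- The Haar probability measure on the torus `𝕋^d = (ℝ / ℤ)^d`. -/
abbrev torusMeasure (d : ℕ) : Measure (UnitAddTorus (Fin d)) :=
  Measure.pi fun _ => AddCircle.haarAddCircle

/-- The character `α ↦ exp (-2 π i n · α)` as an element of `L²(𝕋^d)`. -/
def char {d : ℕ} (n : Fin d → ℤ) : Lp ℂ 2 (torusMeasure d) :=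
  ContinuousMap.toLp (E := ℂ) 2 (torusMeasure d) ℂ (UnitAddTorus.mFourier (-n))

theorem char_orthonormal (d : ℕ) : Orthonormal ℂ (char (d := d)) :=
  (UnitAddTorus.orthonormal_mFourier (d := Fin d)).comp _ neg_injective

/-- The Fourier transform `f̂(α) = ∑ f(n) exp (-2 π i n · α)` of `f ∈ ℓ²(ℤ^d)`, the series
converging unconditionally in `L²(𝕋^d)`. -/
def fourierTransform {d : ℕ} (f : lp (fun _ : Fin d → ℤ => ℂ) 2) : Lp ℂ 2 (torusMeasure d) :=
  ∑' n, f n • char n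

theorem hasSum_fourierTransform {d : ℕ} (f : lp (fun _ : Fin d → ℤ => ℂ) 2) :
    HasSum (fun n => f n • char n) (fourierTransform f) :=
  ((char_orthonormal d).orthogonalFamily.summable_of_lp f).hasSum

/-- For absolutely summable `f` this is the function given by the pointwise series. -/
theorem fourierTransform_ae_eq {d : ℕ} (f : lp (fun _ : Fin d → ℤ => ℂ) 2)
    (hf : Summable fun n => ‖f n‖) :
    fourierTransform f =ᵐ[torusMeasure d]
      fun α => ∑' n, f n * UnitAddTorus.mFourier (-n) α := by
  have hs : Summable fun n => f n • UnitAddTorus.mFourier (d := Fin d) (-n) := by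
    refine Summable.of_norm ?_
    simpa [norm_smul, UnitAddTorus.mFourier_norm] using hf
  have h1 := (ContinuousMap.toLp (E := ℂ) 2 (torusMeasure d) ℂ).hasSum hs.hasSum
  have h2 : HasSum (fun n => f n • char n) (ContinuousMap.toLp (E := ℂ) 2 (torusMeasure d) ℂ
      (∑' n, f n • UnitAddTorus.mFourier (d := Fin d) (-n))) := by
    simpa [Function.comp_def, char] using h1
  rw [(hasSum_fourierTransform f).unique h2]
  filter_upwards [ContinuousMap.coeFn_toLp (𝕜 := ℂ) (p := 2) (torusMeasure d)
    (∑' n, f n • UnitAddTorus.mFourier (d := Fin d) (-n))] with α hα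
  rw [hα, ← ContinuousMap.tsum_apply hs]
  simp

/-- `q_j = lcm {1, 2, …, 2^j}`. -/
def qLcm (j : ℕ) : ℕ := (Finset.Icc 1 (2 ^ j)).lcm id

/-- `Ω_{j,k} ⊆ 𝕋^d`, the image of `[-2^(j-k), 2^(j-k)]^d + (q_j⁻¹ ℤ)^d`. -/
def Omega (d j k : ℕ) : Set (UnitAddTorus (Fin d)) :=
  {α | ∃ (β : Fin d → ℝ) (l : Fin d → ℤ),
    (∀ i, |β i| ≤ (2 : ℝ) ^ ((j : ℤ) - (k : ℤ))) ∧
    ∀ i, α i = ((β i + (l i : ℝ) / (qLcm j : ℝ) : ℝ) : UnitAddCircle)}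

end DiscreteSpherical

end

/-! The spherical sum over `|m|² = N` is a Fourier coefficient, along the horocycle `2 (t + iε)`
with `ε = 4⁻ᵏ`, of the convolution with a complex Gaussian, whose multiplier is a theta function of
`ℤ^d`. This bounds all radii `2ᵏ ≤ λ ≤ 2ᵏ⁺¹` at once by the integral over `t` of the modulus of the
convolution. Cauchy–Schwarz, with the expected size of the theta function as weight, and Parseval
reduce the `ℓ²` bound to estimating `∫ W(t)⁻¹ |θ(t, α)|² dt` for each frequency `α ∉ Ω_{j,k}`.

By Poisson summation the theta function near a reduced fraction `a / q` is small unless each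
coordinate of `α` is within `2^(j-k)` of a fraction with denominator `q`. Off `Ω_{j,k}` some
coordinate has no such approximation with denominator at most `2^j`; two such fractions with
denominators at most `8^j` coincide, so these `q` (up to `8^j`) are all multiples of one integer
greater than `2^j`, and they contribute little to the sum over the Farey arcs. The lower bound for
`N_λ` comes from dimension four: Minkowski's theorem gives at least `n` representations of an odd
`n` as a sum of four squares (one for each `t` mod `n`), and slicing passes to higher dimensions. -/

noncomputable section

open Complex (I)
open scoped Real

namespace DiscreteSpherical

theorem sum_addChar_quadratic_mul_conj {R : Type*} [CommRing R] [Fintype R] [DecidableEq R]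
    {ψ : AddChar R ℂ} (hψ : ψ.IsPrimitive) (a b : R) :
    (∑ r, ψ (a * r ^ 2 + b * r)) * (starRingEnd ℂ) (∑ r, ψ (a * r ^ 2 + b * r)) =
      ∑ h, ψ (a * h ^ 2 + b * h) * if 2 * a * h = 0 then (Fintype.card R : ℂ) else 0 := by
  have hshift (s : R) : ∑ r, ψ (a * r ^ 2 + b * r + -(a * s ^ 2 + b * s)) =
      ∑ h, ψ (a * h ^ 2 + b * h) * ψ (s * (2 * a * h)) := by
    rw [← Equiv.sum_comp (Equiv.addRight s)]
    refine Finset.sum_congr rfl fun h _ => ?_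
    rw [← AddChar.map_add_eq_mul, Equiv.coe_addRight]
    ring_nf
  calc
    _ = ∑ s, ∑ r, ψ (a * r ^ 2 + b * r + -(a * s ^ 2 + b * s)) := by
      simp_rw [map_sum, Finset.sum_mul_sum, ← AddChar.map_neg_eq_conj, ← AddChar.map_add_eq_mul]
      exact Finset.sum_comm
    _ = ∑ h, ∑ s, ψ (a * h ^ 2 + b * h) * ψ (s * (2 * a * h)) := by
      simp_rw [hshift]
      exact Finset.sum_comm
    _ = _ := by
      simp_rw [← Finset.mul_sum, AddChar.sum_mulShift _ hψ, Nat.cast_ite, Nat.cast_zero]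

theorem norm_sq_sum_addChar_quadratic_le {R : Type*} [CommRing R] [Fintype R] [DecidableEq R]
    {ψ : AddChar R ℂ} (hψ : ψ.IsPrimitive) (a b : R) :
    ‖∑ r, ψ (a * r ^ 2 + b * r)‖ ^ 2 ≤
      (Finset.univ.filter fun h : R => 2 * a * h = 0).card * Fintype.card R := by
  calc
    ‖∑ r, ψ (a * r ^ 2 + b * r)‖ ^ 2
        = ‖∑ h, ψ (a * h ^ 2 + b * h) * if 2 * a * h = 0 then (Fintype.card R : ℂ) else 0‖ := by
      rw [← sum_addChar_quadratic_mul_conj hψ, norm_mul, RCLike.norm_conj, sq]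
    _ ≤ ∑ h, ‖ψ (a * h ^ 2 + b * h) * if 2 * a * h = 0 then (Fintype.card R : ℂ) else 0‖ :=
      norm_sum_le _ _
    _ = ∑ h, if 2 * a * h = 0 then (Fintype.card R : ℝ) else 0 := by
      refine Finset.sum_congr rfl fun h _ => ?_
      rw [norm_mul, AddChar.norm_apply, one_mul]
      split_ifs <;> simp
    _ = _ := by
      rw [← Finset.sum_filter, Finset.sum_const, nsmul_eq_mul]

theorem card_two_mul_eq_zero_le (q : ℕ) [NeZero q] :
    (Finset.univ.filter fun h : ZMod q => 2 * h = 0).card ≤ 2 := by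
  have hsub : (Finset.univ.filter fun h : ZMod q => 2 * h = 0) ⊆ {0, ((q / 2 : ℕ) : ZMod q)} := by
    intro h hh
    have hdvd : q ∣ 2 * h.val := by
      rw [← ZMod.natCast_eq_zero_iff]
      simpa using hh
    have hval : h.val = 0 ∨ h.val = q / 2 := by
      have := ZMod.val_lt h
      obtain ⟨c, hc⟩ := hdvd
      have : c < 2 := by nlinarith
      interval_cases c <;> omega
    rw [Finset.mem_insert, Finset.mem_singleton]
    refine hval.imp (ZMod.val_eq_zero h).1 fun h2 => ?_
    rw [← h2, ZMod.natCast_zmod_val]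
  exact (Finset.card_le_card hsub).trans Finset.card_le_two

/-- The quadratic Gauss sum `G(a, b; q) = ∑_{r mod q} exp (2 π i (a r² + b r) / q)`. -/
def quadraticGaussSum (q : ℕ) [NeZero q] (a b : ZMod q) : ℂ :=
  ∑ r, ZMod.stdAddChar (a * r ^ 2 + b * r)

theorem norm_quadraticGaussSum_le {q : ℕ} [NeZero q] {a : ZMod q} (ha : IsUnit a) (b : ZMod q) :
    ‖quadraticGaussSum q a b‖ ≤ √(2 * q) := by
  refine Real.le_sqrt_of_sq_le ?_
  refine (norm_sq_sum_addChar_quadratic_le (ZMod.isPrimitive_stdAddChar q) a b).trans ?_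
  have hker : ∀ h : ZMod q, 2 * a * h = 0 ↔ 2 * h = 0 := fun h => by
    rw [mul_comm 2 a, mul_assoc, ha.mul_right_eq_zero]
  simp_rw [hker, ZMod.card]
  gcongr
  exact_mod_cast card_two_mul_eq_zero_le q

theorem tsum_eq_sum_tsum_mul_add {E : Type*} [NormedAddCommGroup E] [CompleteSpace E]
    {f : ℤ → E} (hf : Summable f) (q : ℕ) [NeZero q] :
    ∑' m, f m = ∑ r : Fin q, ∑' u : ℤ, f (u * q + (r : ℕ)) := by
  set e : Fin q × ℤ ≃ ℤ := (Equiv.prodComm _ _).trans (Int.divModEquiv q).symm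
  exact (e.tsum_eq f).symm.trans ((e.summable_iff.2 hf).tsum_prod.trans (tsum_fintype _))

theorem sum_zmod_eq_sum_fin {M : Type*} [AddCommMonoid M] (q : ℕ) [NeZero q] (f : ZMod q → M) :
    ∑ r, f r = ∑ r : Fin q, f ((r : ℕ) : ZMod q) := by
  have hbij : Function.Bijective fun r : Fin q => ((r : ℕ) : ZMod q) := by
    rw [Fintype.bijective_iff_injective_and_card]
    refine ⟨fun r s h => Fin.ext ?_, by simp⟩
    simpa [ZMod.natCast_eq_natCast_iff', Nat.mod_eq_of_lt] using h
  exact (hbij.sum_comp f).symm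

theorem jacobiTheta₂_term_mul_add (z τ : ℂ) (q : ℕ) [NeZero q] (a u r : ℤ) :
    jacobiTheta₂_term (u * q + r) z (2 * a / q + τ) =
      ZMod.stdAddChar ((a * r ^ 2 : ℤ) : ZMod q) *
        Complex.exp (2 * π * I * r * z + π * I * r ^ 2 * τ) *
          jacobiTheta₂_term u (q * (z + r * τ)) (q ^ 2 * τ) := by
  have hq : (q : ℂ) ≠ 0 := NeZero.ne _
  have hmod : ((a * r ^ 2 : ℤ) : ZMod q) = ((a * (u * q + r) ^ 2 : ℤ) : ZMod q) := by
    push_cast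
    simp
  rw [hmod, ZMod.stdAddChar_coe, jacobiTheta₂_term, jacobiTheta₂_term, ← Complex.exp_add,
    ← Complex.exp_add]
  congr 1
  push_cast
  field_simp
  ring

theorem tsum_jacobiTheta₂_term_mul_add (z : ℂ) {τ : ℂ} (hτ : τ ≠ 0) (q : ℕ) [NeZero q]
    (a r : ℤ) :
    ∑' u : ℤ, jacobiTheta₂_term (u * q + r) z (2 * a / q + τ) =
      1 / (-I * (q ^ 2 * τ)) ^ (1 / 2 : ℂ) * Complex.exp (-π * I * z ^ 2 / τ) *
        (ZMod.stdAddChar ((a * r ^ 2 : ℤ) : ZMod q) *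
          jacobiTheta₂ (z / (q * τ) + r / q) (-1 / (q ^ 2 * τ))) := by
  have hq : (q : ℂ) ≠ 0 := NeZero.ne _
  have hexp : Complex.exp (-π * I * z ^ 2 / τ) =
      Complex.exp (2 * π * I * r * z + π * I * r ^ 2 * τ) *
        Complex.exp (-π * I * (q * (z + r * τ)) ^ 2 / (q ^ 2 * τ)) := by
    rw [← Complex.exp_add]
    congr 1
    field_simp
    ring
  have harg : q * (z + r * τ) / (q ^ 2 * τ) = z / (q * τ) + r / q := by
    field_simp
  simp_rw [jacobiTheta₂_term_mul_add]
  rw [tsum_mul_left, ← jacobiTheta₂, jacobiTheta₂_functional_equation, harg, hexp]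
  ring

theorem jacobiTheta₂_term_add_div (z τ : ℂ) (q : ℕ) [NeZero q] (n r : ℤ) :
    jacobiTheta₂_term n (z + r / q) τ =
      jacobiTheta₂_term n z τ * ZMod.stdAddChar ((n * r : ℤ) : ZMod q) := by
  rw [ZMod.stdAddChar_coe, jacobiTheta₂_term, jacobiTheta₂_term, ← Complex.exp_add]
  congr 1
  push_cast
  ring

theorem im_neg_one_div_sq_mul_pos {τ : ℂ} (hτ : 0 < τ.im) {q : ℝ} (hq : q ≠ 0) :
    0 < (-1 / (q ^ 2 * τ) : ℂ).im := by
  have hτ0 : τ ≠ 0 := fun h => hτ.ne' (by rw [h, Complex.zero_im])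
  have him : (-1 / (q ^ 2 * τ) : ℂ).im = τ.im / Complex.normSq τ / q ^ 2 := by
    rw [← Complex.ofReal_pow, neg_div, one_div, mul_inv, ← Complex.ofReal_inv, Complex.neg_im,
      Complex.im_ofReal_mul, Complex.inv_im]
    ring
  have := Complex.normSq_pos.2 hτ0
  rw [him]
  positivity

/- Poisson summation in each residue class modulo `q`. -/
theorem jacobiTheta₂_two_mul_div_add (z : ℂ) {τ : ℂ} (hτ : 0 < τ.im) (q : ℕ) [NeZero q] (a : ℤ) :
    jacobiTheta₂ z (2 * a / q + τ) =
      1 / (-I * (q ^ 2 * τ)) ^ (1 / 2 : ℂ) * Complex.exp (-π * I * z ^ 2 / τ) *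
        ∑' n : ℤ, jacobiTheta₂_term n (z / (q * τ)) (-1 / (q ^ 2 * τ)) *
          quadraticGaussSum q a n := by
  have hτ0 : τ ≠ 0 := fun h => hτ.ne' (by rw [h, Complex.zero_im])
  have hsum : Summable fun m => jacobiTheta₂_term m z (2 * a / q + τ) := by
    have him : (2 * a / q + τ : ℂ).im = τ.im := by
      have : (2 * a / q : ℂ) = ((2 * a / q : ℝ) : ℂ) := by push_cast; rfl
      rw [this, Complex.add_im, Complex.ofReal_im, zero_add]
    exact (summable_jacobiTheta₂_term_iff _ _).2 (him ▸ hτ)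
  have hdual (w : ℂ) : Summable fun n => jacobiTheta₂_term n w (-1 / (q ^ 2 * τ)) := by
    refine (summable_jacobiTheta₂_term_iff _ _).2 ?_
    exact_mod_cast im_neg_one_div_sq_mul_pos hτ (q := q) (NeZero.ne _)
  set P : ℂ := 1 / (-I * (q ^ 2 * τ)) ^ (1 / 2 : ℂ) * Complex.exp (-π * I * z ^ 2 / τ)
  set g : Fin q → ℤ → ℂ := fun r n => ZMod.stdAddChar ((a * (r : ℕ) ^ 2 : ℤ) : ZMod q) *
    jacobiTheta₂_term n (z / (q * τ) + (r : ℕ) / q) (-1 / (q ^ 2 * τ)) with hg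
  have hg_sum (n : ℤ) : ∑ r, g r n =
      jacobiTheta₂_term n (z / (q * τ)) (-1 / (q ^ 2 * τ)) * quadraticGaussSum q a n := by
    rw [quadraticGaussSum, sum_zmod_eq_sum_fin, Finset.mul_sum]
    refine Finset.sum_congr rfl fun r _ => ?_
    have hshift := jacobiTheta₂_term_add_div (z / (q * τ)) (-1 / (q ^ 2 * τ)) q n r
    rw [Int.cast_natCast] at hshift
    simp only [hg, hshift, AddChar.map_add_eq_mul]
    push_cast
    ring
  calc jacobiTheta₂ z (2 * a / q + τ)
      = ∑ r : Fin q, ∑' u : ℤ, jacobiTheta₂_term (u * q + (r : ℕ)) z (2 * a / q + τ) :=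
        tsum_eq_sum_tsum_mul_add hsum q
    _ = ∑ r : Fin q, P * ∑' n, g r n := by
        refine Finset.sum_congr rfl fun r _ => ?_
        rw [tsum_jacobiTheta₂_term_mul_add z hτ0 q a, tsum_mul_left, Int.cast_natCast]
        rfl
    _ = P * ∑' n, ∑ r, g r n := by
        rw [← Finset.mul_sum, Summable.tsum_finsetSum fun r _ => (hdual _).mul_left _]
    _ = _ := by
        simp_rw [hg_sum]

theorem norm_exp_mul_jacobiTheta₂_term (x : ℝ) {τ : ℂ} (hτ : τ ≠ 0) (q : ℕ) [NeZero q] (n : ℤ) :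
    ‖Complex.exp (-π * I * x ^ 2 / τ) * jacobiTheta₂_term n (x / (q * τ)) (-1 / (q ^ 2 * τ))‖ =
      Real.exp (-(π * (τ.im / ‖τ‖ ^ 2) * (x - n / q) ^ 2)) := by
  have hq : (q : ℂ) ≠ 0 := NeZero.ne _
  have hexp : (-π * I * x ^ 2 / τ + (2 * π * I * n * (x / (q * τ)) +
      π * I * n ^ 2 * (-1 / (q ^ 2 * τ))) : ℂ) =
        ((-(π * (x - n / q) ^ 2) : ℝ) : ℂ) * (I * τ⁻¹) := by
    push_cast
    field_simp
    ring
  rw [jacobiTheta₂_term, ← Complex.exp_add, hexp, Complex.norm_exp, Complex.re_ofReal_mul,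
    Complex.I_mul_re, Complex.inv_im, Complex.normSq_eq_norm_sq]
  ring_nf

theorem summable_exp_neg_mul_sq {c : ℝ} (hc : 0 < c) :
    Summable fun l : ℤ => Real.exp (-(c * l ^ 2)) := by
  have h := ((summable_jacobiTheta₂_term_iff 0 (I * ((c / π : ℝ) : ℂ))).2
    (by rw [Complex.I_mul_im, Complex.ofReal_re]; exact div_pos hc Real.pi_pos)).norm
  refine h.congr fun l => ?_
  rw [norm_jacobiTheta₂_term, Complex.I_mul_im, Complex.ofReal_re, Complex.zero_im]
  congr 1
  field_simp
  ring

theorem sq_div_four_le_add_sq {y : ℝ} (hy : |y| ≤ 1 / 2) (l : ℤ) :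
    (l : ℝ) ^ 2 / 4 ≤ (y + l) ^ 2 := by
  rcases eq_or_ne l 0 with rfl | hl
  · simpa using sq_nonneg y
  · have hone : (1 : ℝ) ≤ |(l : ℝ)| := by exact_mod_cast Int.one_le_abs hl
    have htri : |(l : ℝ)| ≤ |y + l| + |y| := by
      simpa using abs_sub (y + l) y
    have hhalf : |(l : ℝ) / 2| ≤ |y + l| := by
      rw [abs_div, abs_two]
      linarith
    calc (l : ℝ) ^ 2 / 4 = (l / 2 : ℝ) ^ 2 := by ring
      _ ≤ (y + l) ^ 2 := sq_le_sq.2 hhalf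

theorem summable_exp_neg_mul_add_sq {c : ℝ} (hc : 0 < c) (x : ℝ) :
    (Summable fun l : ℤ => Real.exp (-(c * (x + l) ^ 2))) ∧
      ∑' l : ℤ, Real.exp (-(c * (x + l) ^ 2)) ≤ ∑' l : ℤ, Real.exp (-(c / 4 * l ^ 2)) := by
  set e : ℤ ≃ ℤ := Equiv.subRight (round x) with he
  have hle (l : ℤ) : Real.exp (-(c * (x + e l) ^ 2)) ≤ Real.exp (-(c / 4 * l ^ 2)) := by
    have hshift : x + (e l : ℝ) = (x - round x) + l := by
      rw [he, Equiv.subRight_apply]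
      push_cast
      ring
    rw [hshift, Real.exp_le_exp, neg_le_neg_iff, div_mul_eq_mul_div, mul_div_assoc]
    gcongr
    exact sq_div_four_le_add_sq (abs_sub_round x) l
  have hs := summable_exp_neg_mul_sq (c := c / 4) (by positivity)
  have hsum := hs.of_nonneg_of_le (fun _ => by positivity) hle
  refine ⟨e.summable_iff.1 hsum, ?_⟩
  rw [← e.tsum_eq]
  exact hsum.tsum_le_tsum hle hs

/-- The constant in the bound `norm_sq_jacobiTheta₂_le` for theta functions near rationals. -/
def thetaConst : ℝ := 2 * (∑' l : ℤ, Real.exp (-(π / 8 / 4 * l ^ 2))) ^ 2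

theorem thetaConst_pos : 0 < thetaConst := by
  have := (summable_exp_neg_mul_sq (c := π / 8 / 4) (by positivity)).tsum_pos
    (fun _ => by positivity) 0 (by positivity)
  rw [thetaConst]
  positivity

/- Half of the Gaussian decay in `x - n / q` is spent on the factor with `D ^ 2`, the other half on
the sum over `n`. -/
theorem norm_tsum_dual_theta_le {q : ℕ} [NeZero q] {a : ℤ} (ha : IsCoprime a (q : ℤ)) {τ : ℂ}
    (hτ : 0 < τ.im) (hqτ : q ^ 2 * ‖τ‖ ^ 2 ≤ 4 * τ.im) {x D : ℝ} (hD : 0 ≤ D)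
    (hx : ∀ n : ℤ, D ≤ |x - n / q|) :
    ‖Complex.exp (-π * I * x ^ 2 / τ) * ∑' n : ℤ,
        jacobiTheta₂_term n (x / (q * τ)) (-1 / (q ^ 2 * τ)) * quadraticGaussSum q a n‖ ≤
      √(2 * q) * Real.exp (-(π / 2 * (τ.im / ‖τ‖ ^ 2) * D ^ 2)) *
        ∑' l : ℤ, Real.exp (-(π / 8 / 4 * l ^ 2)) := by
  have hτ0 : τ ≠ 0 := fun h => hτ.ne' (by rw [h, Complex.zero_im])
  have hq : (0 : ℝ) < q := by exact_mod_cast Nat.pos_of_neZero q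
  set κ : ℝ := τ.im / ‖τ‖ ^ 2 with hκ
  have hκq : 1 / 4 * q ^ 2 ≤ κ := by
    rw [hκ, le_div_iff₀ (by positivity)]
    linarith
  have hterm (n : ℤ) : ‖Complex.exp (-π * I * x ^ 2 / τ) *
      (jacobiTheta₂_term n (x / (q * τ)) (-1 / (q ^ 2 * τ)) * quadraticGaussSum q a n)‖ ≤
      √(2 * q) * Real.exp (-(π / 2 * κ * D ^ 2)) * Real.exp (-(π / 8 * (-(q * x) + n) ^ 2)) := by
    have hdist : D ^ 2 ≤ (x - n / q) ^ 2 := by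
      rw [← sq_abs (x - n / q)]
      exact pow_le_pow_left₀ hD (hx n) 2
    have hscale : 1 / 4 * (-(q * x) + n) ^ 2 ≤ κ * (x - n / q) ^ 2 := by
      calc 1 / 4 * (-(q * x) + n) ^ 2 = 1 / 4 * q ^ 2 * (x - n / q) ^ 2 := by
            field_simp
            ring
        _ ≤ κ * (x - n / q) ^ 2 := by gcongr
    have hunit : IsUnit (a : ZMod q) := (ZMod.coe_int_isUnit_iff_isCoprime a q).2 ha.symm
    rw [← mul_assoc, norm_mul, norm_exp_mul_jacobiTheta₂_term x hτ0, mul_comm,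
      mul_assoc (√(2 * q)), ← Real.exp_add]
    refine mul_le_mul (norm_quadraticGaussSum_le hunit n) (Real.exp_le_exp.2 ?_)
      (by positivity) (by positivity)
    have hκ0 : 0 ≤ κ := le_trans (by positivity) hκq
    nlinarith [mul_le_mul_of_nonneg_left hscale (half_pos Real.pi_pos).le,
      mul_le_mul_of_nonneg_left hdist (mul_nonneg (half_pos Real.pi_pos).le hκ0)]
  obtain ⟨hs, hle⟩ := summable_exp_neg_mul_add_sq (c := π / 8) (by positivity) (-(q * x))
  rw [← tsum_mul_left]
  refine (tsum_of_norm_bounded (hs.mul_left _).hasSum hterm).trans ?_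
  rw [tsum_mul_left]
  gcongr

theorem norm_sq_one_div_cpow_half (z : ℂ) : ‖1 / z ^ (1 / 2 : ℂ)‖ ^ 2 = ‖z‖⁻¹ := by
  rw [← norm_pow, div_pow, one_pow, ← Complex.cpow_nat_mul, Nat.cast_ofNat, mul_one_div_cancel
    two_ne_zero, Complex.cpow_one, one_div, norm_inv]

theorem norm_sq_jacobiTheta₂_le {q : ℕ} (hq : 0 < q) {a : ℤ} (ha : IsCoprime a (q : ℤ)) {τ : ℂ}
    (hτ : 0 < τ.im) (hqτ : q ^ 2 * ‖τ‖ ^ 2 ≤ 4 * τ.im) {x D : ℝ} (hD : 0 ≤ D)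
    (hx : ∀ n : ℤ, D ≤ |x - n / q|) :
    ‖jacobiTheta₂ x (2 * a / q + τ)‖ ^ 2 ≤
      thetaConst * (q * ‖τ‖)⁻¹ * Real.exp (-(π * (τ.im / ‖τ‖ ^ 2) * D ^ 2)) := by
  have : NeZero q := ⟨hq.ne'⟩
  have hτ0 : τ ≠ 0 := fun h => hτ.ne' (by rw [h, Complex.zero_im])
  have hfactor : ‖1 / (-I * (q ^ 2 * τ)) ^ (1 / 2 : ℂ)‖ ^ 2 = (q ^ 2 * ‖τ‖)⁻¹ := by
    rw [norm_sq_one_div_cpow_half]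
    simp
  have hexp : Real.exp (-(π / 2 * (τ.im / ‖τ‖ ^ 2) * D ^ 2)) ^ 2 =
      Real.exp (-(π * (τ.im / ‖τ‖ ^ 2) * D ^ 2)) := by
    rw [← Real.exp_nat_mul]
    push_cast
    ring_nf
  rw [jacobiTheta₂_two_mul_div_add _ hτ, mul_assoc, norm_mul, mul_pow, hfactor]
  refine (mul_le_mul_of_nonneg_left (pow_le_pow_left₀ (norm_nonneg _)
    (norm_tsum_dual_theta_le ha hτ hqτ hD hx) 2) (by positivity)).trans_eq ?_
  rw [mul_pow, mul_pow, hexp, Real.sq_sqrt (by positivity), thetaConst]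
  field_simp

theorem exists_dvd_sq_add_sq_add_one {p : ℕ} [Fact p.Prime] :
    ∃ a b : ℤ, (p : ℤ) ∣ a ^ 2 + b ^ 2 + 1 ∧ ¬ (p : ℤ) ∣ a := by
  have of_zmod {a b : ZMod p} (hab : a ^ 2 + b ^ 2 = -1) (ha : a ≠ 0) :
      ∃ a b : ℤ, (p : ℤ) ∣ a ^ 2 + b ^ 2 + 1 ∧ ¬ (p : ℤ) ∣ a := by
    refine ⟨a.val, b.val, ?_, ?_⟩ <;> rw [← ZMod.intCast_zmod_eq_zero_iff_dvd]
    · simp [hab]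
    · simpa using ha
  obtain ⟨a, b, hab⟩ := ZMod.sq_add_sq p (-1)
  by_cases ha : a = 0
  · refine of_zmod (add_comm (b ^ 2) _ ▸ hab) fun hb => ?_
    simp [ha, hb] at hab
  · exact of_zmod hab ha

theorem exists_pow_succ_dvd_sq_add {p : ℤ} (hp : Prime p) {k : ℕ} (hk : k ≠ 0) {a c : ℤ}
    (hac : p ^ k ∣ a ^ 2 + c) (ha : ¬ p ∣ 2 * a) :
    ∃ a', p ^ (k + 1) ∣ a' ^ 2 + c ∧ ¬ p ∣ 2 * a' := by
  obtain ⟨k, rfl⟩ := Nat.exists_eq_add_one_of_ne_zero hk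
  obtain ⟨m, hm⟩ := hac
  obtain ⟨u, v, huv⟩ := (hp.irreducible.coprime_iff_not_dvd).2 ha
  refine ⟨a - p ^ (k + 1) * (m * v), ⟨m * u + p ^ k * (m * v) ^ 2, ?_⟩, fun h => ha ?_⟩
  · linear_combination hm - p ^ (k + 1) * m * huv
  · have hshift : p ∣ 2 * (p ^ (k + 1) * (m * v)) :=
      ((dvd_pow_self p (Nat.succ_ne_zero k)).mul_right _).mul_left 2
    exact (dvd_sub_left hshift).1 (by rwa [← mul_sub])

theorem exists_prime_pow_dvd_sq_add_sq_add_one {p : ℕ} [Fact p.Prime] (hp2 : p ≠ 2) (k : ℕ) :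
    ∃ a b : ℤ, (p : ℤ) ^ (k + 1) ∣ a ^ 2 + b ^ 2 + 1 := by
  have hp : Prime (p : ℤ) := Nat.prime_iff_prime_int.1 Fact.out
  obtain ⟨a, b, hab, ha⟩ := exists_dvd_sq_add_sq_add_one (p := p)
  have h2 : ¬ (p : ℤ) ∣ 2 := fun h =>
    hp2 ((Nat.prime_dvd_prime_iff_eq Fact.out Nat.prime_two).1 (by exact_mod_cast h))
  have lift : ∃ a', (p : ℤ) ^ (k + 1) ∣ a' ^ 2 + (b ^ 2 + 1) ∧ ¬ (p : ℤ) ∣ 2 * a' := by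
    induction k with
    | zero => exact ⟨a, by simpa [add_assoc] using hab, fun h => (hp.dvd_or_dvd h).elim h2 ha⟩
    | succ k ih =>
      obtain ⟨a', h, ha'⟩ := ih
      exact exists_pow_succ_dvd_sq_add hp (Nat.succ_ne_zero k) h ha'
  obtain ⟨a', h, -⟩ := lift
  exact ⟨a', b, by rwa [add_assoc]⟩

theorem exists_sq_add_sq_eq_neg_one {n : ℕ} (hn : Odd n) : ∃ a b : ZMod n, a ^ 2 + b ^ 2 = -1 := by
  induction n using Nat.recOnPosPrimePosCoprime with
  | zero => simp at hn
  | one => exact ⟨0, 0, Subsingleton.elim _ _⟩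
  | prime_pow p k hp hk =>
    have : Fact p.Prime := ⟨hp⟩
    obtain ⟨k, rfl⟩ := Nat.exists_eq_succ_of_ne_zero hk.ne'
    have hp2 : p ≠ 2 := by
      rintro rfl
      exact Nat.not_odd_iff_even.2 (even_two.pow_of_ne_zero (Nat.succ_ne_zero k)) hn
    obtain ⟨a, b, h⟩ := exists_prime_pow_dvd_sq_add_sq_add_one hp2 k
    refine ⟨a, b, eq_neg_of_add_eq_zero_left ?_⟩
    rw [← Nat.cast_pow, ← ZMod.intCast_zmod_eq_zero_iff_dvd] at h
    exact_mod_cast h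
  | coprime m n _ _ hmn ihm ihn =>
    rw [Nat.odd_mul] at hn
    obtain ⟨a, b, h1⟩ := ihm hn.1
    obtain ⟨c, d, h2⟩ := ihn hn.2
    set e := ZMod.chineseRemainder hmn
    refine ⟨e.symm (a, c), e.symm (b, d), e.injective ?_⟩
    simp [Prod.ext_iff, h1, h2]

section Minkowski

variable {ι : Type*}

/-- A subgroup of `ℤ^ι`, regarded as a lattice in `ℝ^ι`. -/
def realLattice (Λ : AddSubgroup (ι → ℤ)) : Submodule ℤ (ι → ℝ) :=
  AddSubgroup.toIntSubmodule (Λ.map ((Int.castAddHom ℝ).compLeft ι))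

theorem intCast_compLeft_injective : Function.Injective ((Int.castAddHom ℝ).compLeft ι) :=
  fun _ _ h => funext fun i => Int.cast_injective (congrFun h i)

theorem realLattice_mono {Λ Λ' : AddSubgroup (ι → ℤ)} (h : Λ ≤ Λ') :
    realLattice Λ ≤ realLattice Λ' :=
  AddSubgroup.map_mono h

theorem realLattice_top [Finite ι] :
    realLattice (⊤ : AddSubgroup (ι → ℤ)) = Submodule.span ℤ (Set.range (Pi.basisFun ℝ ι)) := by
  ext x
  rw [Module.Basis.mem_span_iff_repr_mem]
  simp only [Pi.basisFun_repr, Set.mem_range]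
  refine ⟨?_, fun h => ?_⟩
  · rintro ⟨v, -, rfl⟩ i
    exact ⟨v i, rfl⟩
  · choose v hv using h
    exact ⟨v, trivial, funext hv⟩

instance [Finite ι] (Λ : AddSubgroup (ι → ℤ)) : DiscreteTopology (realLattice Λ) := by
  have := Fintype.ofFinite ι
  have : DiscreteTopology (realLattice (⊤ : AddSubgroup (ι → ℤ))) := by
    rw [realLattice_top]
    infer_instance
  exact DiscreteTopology.of_subset this (realLattice_mono le_top)

variable [Fintype ι]

instance (Λ : AddSubgroup (ι → ℤ)) [Λ.FiniteIndex] : IsZLattice ℝ (realLattice Λ) := by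
  classical
  refine ⟨?_⟩
  rw [eq_top_iff, ← (Pi.basisFun ℝ ι).span_eq, Submodule.span_le]
  rintro _ ⟨i, rfl⟩
  have hindex : (Λ.index : ℝ) ≠ 0 := by exact_mod_cast AddSubgroup.FiniteIndex.index_ne_zero
  have hmem : (Λ.index : ℝ) • Pi.basisFun ℝ ι i ∈ realLattice Λ := by
    refine ⟨Λ.index • Pi.single i 1, Λ.nsmul_index_mem _, ?_⟩
    ext l
    simp [Pi.single_apply]
  rw [SetLike.mem_coe, ← inv_smul_smul₀ hindex (Pi.basisFun ℝ ι i)]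
  exact Submodule.smul_mem _ _ (Submodule.subset_span hmem)

theorem covolume_realLattice (Λ : AddSubgroup (ι → ℤ)) [Λ.FiniteIndex] :
    ZLattice.covolume (realLattice Λ) = Λ.index := by
  have htop : ZLattice.covolume (realLattice (⊤ : AddSubgroup (ι → ℤ))) = 1 := by
    simp_rw [realLattice_top]
    rw [ZLattice.covolume_eq_measure_fundamentalDomain _ volume
      (ZSpan.isAddFundamentalDomain (Pi.basisFun ℝ ι) volume), measureReal_def,
      ZSpan.fundamentalDomain_pi_basisFun, volume_pi_pi]
    simp
  have h := ZLattice.covolume_div_covolume_eq_relIndex _ _ (realLattice_mono (le_top (a := Λ)))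
  rw [htop, div_one] at h
  rw [h]
  congr 1
  exact (AddSubgroup.relIndex_map_map_of_injective _ _ intCast_compLeft_injective).trans
    (AddSubgroup.relIndex_top_right _)

theorem exists_ne_zero_mem_of_index_mul_two_pow_lt_volume (Λ : AddSubgroup (ι → ℤ))
    [Λ.FiniteIndex] {s : Set (ι → ℝ)} (hsymm : ∀ x ∈ s, -x ∈ s) (hconv : Convex ℝ s)
    (hs : (Λ.index * 2 ^ Fintype.card ι : ℝ≥0∞) < volume s) :
    ∃ v ∈ Λ, v ≠ 0 ∧ (fun i => (v i : ℝ)) ∈ s := by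
  have : Countable (realLattice Λ).toAddSubgroup := inferInstanceAs (Countable (realLattice Λ))
  have hfund := ZLattice.isAddFundamentalDomain (IsZLattice.basis (realLattice Λ)) volume
  have hF := ZLattice.covolume_eq_measure_fundamentalDomain (realLattice Λ) volume hfund
  rw [covolume_realLattice] at hF
  have hFtop := (ZSpan.fundamentalDomain_isBounded ((IsZLattice.basis
    (realLattice Λ)).ofZLatticeBasis ℝ (realLattice Λ))).measure_lt_top (μ := volume).ne
  have hvol := (ENNReal.ofReal_toReal hFtop).symm
  rw [← measureReal_def, ← hF, ENNReal.ofReal_natCast] at hvol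
  obtain ⟨⟨x, v, hv, rfl⟩, hx0, hx⟩ :=
    exists_ne_zero_mem_lattice_of_measure_mul_two_pow_lt_measure
      (L := (realLattice Λ).toAddSubgroup) hfund hsymm hconv
      (by rwa [hvol, Module.finrank_fintype_fun_eq_card])
  refine ⟨v, hv, ?_, hx⟩
  rintro rfl
  exact hx0 (Subtype.ext (map_zero _))

end Minkowski

theorem exists_ne_zero_mem_sum_sq_lt (Λ : AddSubgroup (Fin 4 → ℤ)) [Λ.FiniteIndex] {n : ℕ}
    (hn : 0 < n) (hΛ : Λ.index ≤ n ^ 2) : ∃ v ∈ Λ, v ≠ 0 ∧ ∑ i, v i ^ 2 < 2 * (n : ℤ) := by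
  set B : Set (Fin 4 → ℝ) := WithLp.toLp 2 ⁻¹' Metric.ball 0 √(2 * n) with hB
  have hmem (x : Fin 4 → ℝ) : x ∈ B ↔ ∑ i, x i ^ 2 < 2 * n := by
    rw [hB, Set.mem_preimage, mem_ball_zero_iff, EuclideanSpace.norm_eq,
      Real.sqrt_lt_sqrt_iff (by positivity)]
    simp
  have hconv : Convex ℝ B :=
    (convex_ball _ _).linear_preimage (WithLp.linearEquiv 2 ℝ (Fin 4 → ℝ)).symm.toLinearMap
  have hvol : volume B = ENNReal.ofReal (2 * π ^ 2 * n ^ 2) := by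
    rw [hB, (PiLp.volume_preserving_toLp (Fin 4)).measure_preimage
      measurableSet_ball.nullMeasurableSet,
      InnerProductSpace.volume_ball_of_dim_even (k := 2) (by simp), finrank_euclideanSpace_fin,
      ← ENNReal.ofReal_pow (by positivity), ← ENNReal.ofReal_mul (by positivity),
      pow_mul √(2 * n) 2 2, Real.sq_sqrt (by positivity)]
    congr 1
    norm_num
    ring
  have hlt : (Λ.index * 2 ^ Fintype.card (Fin 4) : ℝ≥0∞) < volume B := by
    have hn' : (1 : ℝ) ≤ n ^ 2 := one_le_pow₀ (by exact_mod_cast hn)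
    have hindex : (Λ.index : ℝ) ≤ n ^ 2 := by exact_mod_cast hΛ
    rw [hvol, Fintype.card_fin, ← ENNReal.ofReal_natCast, ← ENNReal.ofReal_ofNat,
      ← ENNReal.ofReal_pow (by positivity), ← ENNReal.ofReal_mul (by positivity),
      ENNReal.ofReal_lt_ofReal_iff (by positivity)]
    have hpi : (9 : ℝ) < π ^ 2 := by nlinarith [Real.pi_gt_three]
    nlinarith
  obtain ⟨v, hv, hv0, hvB⟩ := exists_ne_zero_mem_of_index_mul_two_pow_lt_volume Λ
    (fun x hx => (hmem _).2 (by simpa using (hmem x).1 hx)) hconv hlt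
  exact ⟨v, hv, hv0, by exact_mod_cast (hmem _).1 hvB⟩

/-- When `a ^ 2 + b ^ 2 = -1` modulo `n`, the quaternion with coordinates `v` is represented modulo
`n` by a `2 × 2` matrix of determinant `∑ i, v i ^ 2`. This homomorphism applies the row vector
`(t, 1)` to that matrix, so its kernel consists of those `v` whose matrix is annihilated by the
point `(t : 1)` of the projective line. -/
def splitHom (n : ℕ) (a b t : ℤ) : (Fin 4 → ℤ) →+ ZMod n × ZMod n where
  toFun v := (((-v 1 + b * v 2 + a * v 3 + t * (v 0 + a * v 2 - b * v 3) : ℤ) : ZMod n),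
    ((v 0 - a * v 2 + b * v 3 + t * (v 1 + b * v 2 + a * v 3) : ℤ) : ZMod n))
  map_zero' := by simp
  map_add' v w := by
    ext <;> simp only [Pi.add_apply, Prod.fst_add, Prod.snd_add] <;> push_cast <;> ring

theorem splitHom_eq_zero_iff {n : ℕ} {a b t : ℤ} {v : Fin 4 → ℤ} :
    splitHom n a b t v = 0 ↔
      (n : ℤ) ∣ -v 1 + b * v 2 + a * v 3 + t * (v 0 + a * v 2 - b * v 3) ∧
      (n : ℤ) ∣ v 0 - a * v 2 + b * v 3 + t * (v 1 + b * v 2 + a * v 3) := by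
  rw [← ZMod.intCast_zmod_eq_zero_iff_dvd, ← ZMod.intCast_zmod_eq_zero_iff_dvd]
  exact Prod.ext_iff

theorem dvd_sum_sq_of_splitHom_eq_zero {n : ℕ} {a b t : ℤ} (hab : (n : ℤ) ∣ a ^ 2 + b ^ 2 + 1)
    {v : Fin 4 → ℤ} (h : splitHom n a b t v = 0) : (n : ℤ) ∣ ∑ i, v i ^ 2 := by
  obtain ⟨c, hc⟩ := hab
  obtain ⟨⟨x, hx⟩, ⟨y, hy⟩⟩ := splitHom_eq_zero_iff.1 h
  refine ⟨c * (v 2 ^ 2 + v 3 ^ 2) + (v 0 + a * v 2 - b * v 3) * y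
    - (v 1 + b * v 2 + a * v 3) * x, ?_⟩
  rw [Fin.sum_univ_four]
  linear_combination (v 2 ^ 2 + v 3 ^ 2) * hc + (v 0 + a * v 2 - b * v 3) * hy
    - (v 1 + b * v 2 + a * v 3) * hx

theorem dvd_two_mul_sub_mul_of_splitHom_eq_zero {n : ℕ} {a b t t' : ℤ}
    (hab : (n : ℤ) ∣ a ^ 2 + b ^ 2 + 1) {v : Fin 4 → ℤ} (h : splitHom n a b t v = 0)
    (h' : splitHom n a b t' v = 0) (i : Fin 4) : (n : ℤ) ∣ 2 * (t - t') * v i := by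
  obtain ⟨⟨x, hx⟩, ⟨y, hy⟩⟩ := splitHom_eq_zero_iff.1 h
  obtain ⟨⟨x', hx'⟩, ⟨y', hy'⟩⟩ := splitHom_eq_zero_iff.1 h'
  have hA : (n : ℤ) ∣ (t - t') * (v 0 + a * v 2 - b * v 3) :=
    ⟨x - x', by linear_combination hx - hx'⟩
  have hB : (n : ℤ) ∣ (t - t') * (v 1 + b * v 2 + a * v 3) :=
    ⟨y - y', by linear_combination hy - hy'⟩
  have hC : (n : ℤ) ∣ (t - t') * (-v 1 + b * v 2 + a * v 3) :=
    ⟨t * x' - t' * x, by linear_combination t * hx' - t' * hx⟩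
  have hD : (n : ℤ) ∣ (t - t') * (v 0 - a * v 2 + b * v 3) :=
    ⟨t * y' - t' * y, by linear_combination t * hy' - t' * hy⟩
  have h0 : (n : ℤ) ∣ 2 * (t - t') * v 0 := by
    rw [show 2 * (t - t') * v 0 = (t - t') * (v 0 + a * v 2 - b * v 3) +
      (t - t') * (v 0 - a * v 2 + b * v 3) by ring]
    exact hA.add hD
  have h1 : (n : ℤ) ∣ 2 * (t - t') * v 1 := by
    rw [show 2 * (t - t') * v 1 = (t - t') * (v 1 + b * v 2 + a * v 3) -
      (t - t') * (-v 1 + b * v 2 + a * v 3) by ring]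
    exact hB.sub hC
  have h2 : (n : ℤ) ∣ 2 * (t - t') * v 2 := by
    rw [show 2 * (t - t') * v 2 = 2 * (t - t') * v 2 * (a ^ 2 + b ^ 2 + 1) -
      (a * ((t - t') * (v 0 + a * v 2 - b * v 3) - (t - t') * (v 0 - a * v 2 + b * v 3)) +
        b * ((t - t') * (v 1 + b * v 2 + a * v 3) + (t - t') * (-v 1 + b * v 2 + a * v 3)))
      by ring]
    exact (hab.mul_left _).sub (((hA.sub hD).mul_left a).add ((hB.add hC).mul_left b))
  have h3 : (n : ℤ) ∣ 2 * (t - t') * v 3 := by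
    rw [show 2 * (t - t') * v 3 = 2 * (t - t') * v 3 * (a ^ 2 + b ^ 2 + 1) -
      (a * ((t - t') * (v 1 + b * v 2 + a * v 3) + (t - t') * (-v 1 + b * v 2 + a * v 3)) -
        b * ((t - t') * (v 0 + a * v 2 - b * v 3) - (t - t') * (v 0 - a * v 2 + b * v 3)))
      by ring]
    exact (hab.mul_left _).sub (((hB.add hC).mul_left a).sub ((hA.sub hD).mul_left b))
  fin_cases i
  exacts [h0, h1, h2, h3]

/- Dividing `∑ i, v i ^ 2 = n` by `n`, the splitting identity writes `1` as a combination of the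
`v i`, all of which `2 * (t - t')` sends to multiples of `n`. -/
theorem dvd_two_mul_sub_of_splitHom_eq_zero {n : ℕ} (hn : n ≠ 0) {a b t t' : ℤ}
    (hab : (n : ℤ) ∣ a ^ 2 + b ^ 2 + 1) {v : Fin 4 → ℤ} (hv : ∑ i, v i ^ 2 = (n : ℤ))
    (h : splitHom n a b t v = 0) (h' : splitHom n a b t' v = 0) : (n : ℤ) ∣ 2 * (t - t') := by
  have hdvd := dvd_two_mul_sub_mul_of_splitHom_eq_zero hab h h'
  obtain ⟨c, hc⟩ := hab
  obtain ⟨⟨x, hx⟩, ⟨y, hy⟩⟩ := splitHom_eq_zero_iff.1 h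
  have hone : v 0 * y + v 1 * (-x) + v 2 * (c * v 2 + a * y - b * x) +
      v 3 * (c * v 3 - b * y - a * x) = 1 := by
    refine mul_left_cancel₀ (Int.natCast_ne_zero.2 hn) ?_
    rw [Fin.sum_univ_four] at hv
    linear_combination hv - (v 2 ^ 2 + v 3 ^ 2) * hc - (v 0 + a * v 2 - b * v 3) * hy
      + (v 1 + b * v 2 + a * v 3) * hx
  rw [← mul_one (2 * (t - t')), ← hone]
  simp only [mul_add, ← mul_assoc]
  exact ((((hdvd 0).mul_right _).add ((hdvd 1).mul_right _)).add ((hdvd 2).mul_right _)).add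
    ((hdvd 3).mul_right _)

theorem exists_sum_sq_eq_of_dvd_sq_add_sq_add_one {n : ℕ} (hn : 0 < n) {a b : ℤ}
    (hab : (n : ℤ) ∣ a ^ 2 + b ^ 2 + 1) (t : ℤ) :
    ∃ v : Fin 4 → ℤ, ∑ i, v i ^ 2 = (n : ℤ) ∧ splitHom n a b t v = 0 := by
  have : NeZero n := ⟨hn.ne'⟩
  have hindex : (splitHom n a b t).ker.index ≤ n ^ 2 := by
    rw [AddSubgroup.index_ker]
    exact (Nat.card_le_card_of_injective _ Subtype.val_injective).trans_eq
      (by rw [Nat.card_prod, Nat.card_zmod, sq])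
  obtain ⟨v, hv, hv0, hlt⟩ := exists_ne_zero_mem_sum_sq_lt (splitHom n a b t).ker hn hindex
  obtain ⟨c, hc⟩ := dvd_sum_sq_of_splitHom_eq_zero hab hv
  have hpos : 0 < ∑ i, v i ^ 2 := by
    obtain ⟨i, hi⟩ := Function.ne_iff.1 hv0
    exact Finset.sum_pos' (fun _ _ => sq_nonneg _) ⟨i, Finset.mem_univ _, sq_pos_of_ne_zero hi⟩
  have hn' : (0 : ℤ) < n := by exact_mod_cast hn
  have hc0 : 0 < c := pos_of_mul_pos_right (hc ▸ hpos) hn'.le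
  have hc2 : c < 2 := lt_of_mul_lt_mul_left (by rwa [← hc, mul_comm (n : ℤ)]) hn'.le
  exact ⟨v, by rw [hc, show c = 1 by omega, mul_one], hv⟩

theorem mem_sphere_sqrt {d N : ℕ} {m : Fin d → ℤ} :
    m ∈ sphere d √N ↔ ∑ i, m i ^ 2 = (N : ℤ) := by
  rw [sphere, Set.Finite.mem_toFinset, sphereSet, Set.mem_ofPred_eq,
    Real.sqrt_inj (by positivity) (by positivity)]
  exact_mod_cast Iff.rfl

theorem le_card_sphere_four {n : ℕ} (hn : Odd n) : n ≤ (sphere 4 √n).card := by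
  obtain ⟨a', b', hab'⟩ := exists_sq_add_sq_eq_neg_one hn
  obtain ⟨a, rfl⟩ := ZMod.intCast_surjective a'
  obtain ⟨b, rfl⟩ := ZMod.intCast_surjective b'
  have hab : (n : ℤ) ∣ a ^ 2 + b ^ 2 + 1 := by
    rw [← ZMod.intCast_zmod_eq_zero_iff_dvd]
    push_cast
    rw [hab', neg_add_cancel]
  choose v hv hsplit using exists_sum_sq_eq_of_dvd_sq_add_sq_add_one hn.pos hab
  have hinj : Set.InjOn (fun t : ℕ => v t) (Finset.range n) := by
    intro t ht s hs hts
    have htwo := dvd_two_mul_sub_of_splitHom_eq_zero hn.pos.ne' hab (hv t) (hsplit t)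
      ((congrArg _ hts).trans (hsplit s))
    have hdvd : (n : ℤ) ∣ t - s := by
      refine IsCoprime.dvd_of_dvd_mul_left ?_ htwo
      exact Nat.isCoprime_iff_coprime.2 (Nat.coprime_two_right.2 hn)
    simp only [Finset.coe_range, Set.mem_Iio] at ht hs
    have := Int.eq_zero_of_abs_lt_dvd hdvd (by rw [abs_lt]; constructor <;> omega)
    omega
  simpa using Finset.card_le_card_of_injOn (s := Finset.range n) _
    (fun t _ => mem_sphere_sqrt.2 (hv t)) hinj

theorem sum_card_sphere_le {d N : ℕ} {S : Finset ℕ} (hS : ∀ m ∈ S, m ^ 2 ≤ N) :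
    ∑ m ∈ S, (sphere d √((N - m ^ 2 : ℕ) : ℝ)).card ≤ (sphere (d + 1) √N).card := by
  rw [← Finset.card_sigma]
  refine Finset.card_le_card_of_injOn (fun x => (Fin.cons (x.1 : ℤ) x.2 : Fin (d + 1) → ℤ)) ?_ ?_
  · rintro ⟨m, v⟩ hx
    simp only [Finset.coe_sigma, Set.mem_sigma_iff, Finset.mem_coe] at hx
    rw [Finset.mem_coe, mem_sphere_sqrt, Fin.sum_univ_succ]
    simp only [Fin.cons_zero, Fin.cons_succ]
    rw [mem_sphere_sqrt.1 hx.2]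
    push_cast [hS m hx.1]
    ring
  · rintro ⟨m, v⟩ _ ⟨m', v'⟩ _ h
    obtain ⟨hm, hv⟩ := Fin.cons_injective2 (α := fun _ => ℤ) h
    obtain rfl : m = m' := by exact_mod_cast hm
    exact congrArg _ hv

theorem card_sphere_succ_ge {d N : ℕ} {c s : ℝ} (hc : 0 ≤ c) (hs : 0 ≤ s) (hN : 0 < N)
    {S : Finset ℕ} (hS : ∀ m ∈ S, 2 * m ^ 2 ≤ N) (hcard : √N ≤ 8 * S.card)
    (hsphere : ∀ m ∈ S, c * ((N - m ^ 2 : ℕ) : ℝ) ^ s ≤ (sphere d √((N - m ^ 2 : ℕ) : ℝ)).card) :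
    c * (1 / 2) ^ s / 8 * (N : ℝ) ^ (s + 1 / 2) ≤ (sphere (d + 1) √N).card := by
  have hN' : (0 : ℝ) < N := by exact_mod_cast hN
  have hsq : ∀ m ∈ S, m ^ 2 ≤ N := fun m hm => by have := hS m hm; omega
  calc c * (1 / 2) ^ s / 8 * (N : ℝ) ^ (s + 1 / 2)
      = √N / 8 * (c * (1 / 2 * N) ^ s) := by
        rw [Real.rpow_add hN', Real.mul_rpow (by positivity) hN'.le, Real.sqrt_eq_rpow]
        ring
    _ ≤ S.card * (c * (1 / 2 * N) ^ s) := by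
        gcongr
        linarith
    _ = ∑ _m ∈ S, c * (1 / 2 * N : ℝ) ^ s := by
        rw [Finset.sum_const, nsmul_eq_mul]
    _ ≤ ∑ m ∈ S, ((sphere d √((N - m ^ 2 : ℕ) : ℝ)).card : ℝ) := by
        refine Finset.sum_le_sum fun m hm => le_trans ?_ (hsphere m hm)
        have : 2 * (m : ℝ) ^ 2 ≤ N := by exact_mod_cast hS m hm
        rw [Nat.cast_sub (hsq m hm), Nat.cast_pow]
        gcongr
        linarith
    _ ≤ (sphere (d + 1) √N).card := by
        exact_mod_cast sum_card_sphere_le hsq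

theorem sqrt_le_two_mul_sqrt_half_succ (N : ℕ) : √N ≤ 2 * (Nat.sqrt (N / 2) + 1 : ℕ) := by
  refine Real.sqrt_le_iff.2 ⟨by positivity, ?_⟩
  have := Nat.succ_le_succ_sqrt (N / 2)
  have h : N ≤ (2 * (Nat.sqrt (N / 2) + 1)) ^ 2 := by
    rw [mul_pow]
    rw [← sq] at this
    omega
  exact_mod_cast h

theorem two_mul_sq_le_of_le_sqrt_half {m N : ℕ} (h : m ≤ Nat.sqrt (N / 2)) : 2 * m ^ 2 ≤ N := by
  have := Nat.le_sqrt'.1 h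
  omega

theorem exists_odd_slices {N : ℕ} (hN : 0 < N) :
    ∃ S : Finset ℕ, (∀ m ∈ S, 2 * m ^ 2 ≤ N) ∧ (∀ m ∈ S, Odd (N - m ^ 2)) ∧ √N ≤ 8 * S.card := by
  obtain ⟨e, he, hpar⟩ : ∃ e : ℕ, e ≤ 1 ∧ (N + e) % 2 = 1 := ⟨(N + 1) % 2, by omega, by omega⟩
  set r := Nat.sqrt (N / 2)
  have her : e ≤ r := by
    rcases eq_or_ne N 1 with rfl | h
    · omega
    · exact he.trans (Nat.le_sqrt'.2 (by omega))
  set S := (Finset.range ((r + 2 - e) / 2)).image fun i => 2 * i + e with hS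
  have hle : ∀ m ∈ S, 2 * m ^ 2 ≤ N := by
    intro m hm
    obtain ⟨i, hi, rfl⟩ := Finset.mem_image.1 hm
    rw [Finset.mem_range] at hi
    exact two_mul_sq_le_of_le_sqrt_half (by omega)
  refine ⟨S, hle, fun m hm => ?_, ?_⟩
  · have := hle m hm
    obtain ⟨i, -, rfl⟩ := Finset.mem_image.1 hm
    have hmod : (2 * i + e) ^ 2 % 2 = e % 2 := by
      rw [Nat.pow_mod, Nat.mul_add_mod]
      interval_cases e <;> rfl
    rw [Nat.odd_iff]
    omega
  · have hcard : r + 1 ≤ 4 * S.card := by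
      rw [hS, Finset.card_image_of_injective _ fun i i' h => by simpa using h, Finset.card_range]
      omega
    have : ((r + 1 : ℕ) : ℝ) ≤ 4 * S.card := by exact_mod_cast hcard
    linarith [sqrt_le_two_mul_sqrt_half_succ N]

/- The lower bound fails in dimension four, where `n` odd is needed; slicing restores all `N` in
dimension five and then propagates to every higher dimension. -/
theorem card_sphere_ge (d : ℕ) (hd : 5 ≤ d) : ∃ c : ℝ, 0 < c ∧ ∀ N : ℕ, 1 ≤ N →
    c * (N : ℝ) ^ ((d : ℝ) / 2 - 1) ≤ (sphere d √N).card := by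
  induction d, hd using Nat.le_induction with
  | base =>
    refine ⟨1 * (1 / 2) ^ (1 : ℝ) / 8, by positivity, fun N hN => ?_⟩
    obtain ⟨S, hle, hodd, hcard⟩ := exists_odd_slices hN
    convert card_sphere_succ_ge zero_le_one zero_le_one hN hle hcard fun m hm => ?_ using 3
    · norm_num
    · rw [one_mul, Real.rpow_one]
      exact_mod_cast le_card_sphere_four (hodd m hm)
  | succ d hd ih =>
    obtain ⟨c, hc, hcN⟩ := ih
    have hd' : (5 : ℝ) ≤ d := by exact_mod_cast hd
    refine ⟨c * (1 / 2) ^ ((d : ℝ) / 2 - 1) / 8, by positivity, fun N hN => ?_⟩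
    have hle : ∀ m ∈ Finset.range (Nat.sqrt (N / 2) + 1), 2 * m ^ 2 ≤ N := fun m hm =>
      two_mul_sq_le_of_le_sqrt_half (Finset.mem_range_succ_iff.1 hm)
    have hcard : √N ≤ 8 * (Finset.range (Nat.sqrt (N / 2) + 1)).card := by
      rw [Finset.card_range]
      linarith [sqrt_le_two_mul_sqrt_half_succ N, (Nat.sqrt (N / 2) + 1).cast_nonneg (α := ℝ)]
    convert card_sphere_succ_ge hc.le (by linarith) hN hle hcard fun m hm => hcN _ ?_ using 2
    · push_cast
      ring_nf
    · have := hle m hm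
      omega

theorem summable_norm_and_tsum_pi_prod {α R : Type*} [NormedCommRing R] [NormOneClass R]
    [CompleteSpace R] {d : ℕ} (g : Fin d → α → R) (hg : ∀ i, Summable fun k => ‖g i k‖) :
    (Summable fun m : Fin d → α => ‖∏ i, g i (m i)‖) ∧
      ∑' m : Fin d → α, ∏ i, g i (m i) = ∏ i, ∑' k, g i k := by
  induction d with
  | zero => exact ⟨Summable.of_finite, by rw [tsum_fintype]; simp⟩
  | succ d ih =>
    obtain ⟨hsum, htsum⟩ := ih (fun i => g i.succ) (fun i => hg i.succ)
    let e : α × (Fin d → α) ≃ (Fin (d + 1) → α) := Fin.consEquiv fun _ => α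
    have he (p : α × (Fin d → α)) :
        ∏ i, g i (e p i) = g 0 p.1 * ∏ i, g (Fin.succ i) (p.2 i) := by
      simp [Fin.prod_univ_succ, e, Fin.consEquiv]
    constructor
    · refine e.summable_iff.1 (((hg 0).mul_norm hsum).congr fun p => ?_)
      rw [Function.comp_apply, he]
    · rw [← e.tsum_eq, Fin.prod_univ_succ, ← htsum, tsum_mul_tsum_of_summable_norm (hg 0) hsum]
      exact tsum_congr he

/-- The point `2 (t + iε)` of the upper half-plane. For fixed `ε` it moves along a horocycle at the
cusp `i∞`, and `t ∈ (0, 1]` is one period of the functions `exp (π i k ·)` with `k ∈ ℤ`. -/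
def horocycle (ε t : ℝ) : ℂ := 2 * (t + ε * I)

theorem horocycle_im (ε t : ℝ) : (horocycle ε t).im = 2 * ε := by
  simp [horocycle]

theorem continuous_horocycle (ε : ℝ) : Continuous (horocycle ε) := by
  unfold horocycle
  fun_prop

theorem integral_exp_horocycle (ε : ℝ) (k : ℤ) :
    ∫ t in Set.Ioc (0 : ℝ) 1, Complex.exp (π * I * horocycle ε t * k) = if k = 0 then 1 else 0 := by
  rw [← intervalIntegral.integral_of_le zero_le_one]
  split_ifs with hk
  · simp [hk]
  · have hsplit (t : ℝ) : Complex.exp (π * I * horocycle ε t * k) =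
        Complex.exp (-(2 * π * ε * k)) * Complex.exp (2 * π * k * I * t) := by
      rw [← Complex.exp_add, horocycle]
      congr 1
      linear_combination (2 * π * ε * k : ℂ) * Complex.I_sq
    have hperiod : Complex.exp (2 * π * k * I * (1 : ℝ)) = 1 :=
      Complex.exp_eq_one_iff.2 ⟨k, by push_cast; ring⟩
    simp_rw [hsplit]
    rw [intervalIntegral.integral_const_mul,
      integral_exp_mul_complex (by simp [Real.pi_ne_zero, hk]), hperiod]
    simp

section Multiplier

variable {d : ℕ}

/-- The quadratic phase `exp (π i τ |m|²)` on `ℤ^d`, a complex Gaussian when `0 < Im τ`. -/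
def gaussPhase (τ : ℂ) (m : Fin d → ℤ) : ℂ :=
  Complex.exp (π * I * τ * (∑ i, m i ^ 2 : ℤ))

/-- The theta function of `ℤ^d` on the torus, the multiplier of convolution with `gaussPhase τ`. -/
def torusTheta (τ : ℂ) (α : UnitAddTorus (Fin d)) : ℂ :=
  ∑' m, gaussPhase τ m * UnitAddTorus.mFourier (-m) α

/-- Convolution of `f` with `gaussPhase τ`: the generating function of the sums of `f (n - ·)` over
the spheres `|m|² = N`. -/
def gaussConv (τ : ℂ) (f : (Fin d → ℤ) → ℂ) (n : Fin d → ℤ) : ℂ :=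
  ∑' m, gaussPhase τ m * f (n - m)

theorem norm_gaussPhase_horocycle (ε t : ℝ) (m : Fin d → ℤ) :
    ‖gaussPhase (horocycle ε t) m‖ = ‖gaussPhase (horocycle ε 0) m‖ := by
  rw [gaussPhase, gaussPhase]
  generalize (∑ i, m i ^ 2) = k
  simp [Complex.norm_exp, horocycle]

theorem continuous_gaussPhase_horocycle (ε : ℝ) (m : Fin d → ℤ) :
    Continuous fun t => gaussPhase (horocycle ε t) m := by
  have := continuous_horocycle ε
  unfold gaussPhase
  fun_prop

theorem norm_mFourier_apply (n : Fin d → ℤ) (α : UnitAddTorus (Fin d)) :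
    ‖UnitAddTorus.mFourier n α‖ = 1 := by
  simp only [UnitAddTorus.mFourier, ContinuousMap.coe_mk, norm_prod, fourier_apply,
    Circle.norm_coe, Finset.prod_const_one]

theorem gaussPhase_mul_mFourier (τ : ℂ) (m : Fin d → ℤ) (β : Fin d → ℝ) :
    gaussPhase τ m * UnitAddTorus.mFourier (-m) (fun i => (β i : UnitAddCircle)) =
      ∏ i, jacobiTheta₂_term (m i) (-β i) τ := by
  simp only [UnitAddTorus.mFourier, ContinuousMap.coe_mk, Pi.neg_apply, fourier_coe_apply,
    gaussPhase, jacobiTheta₂_term, ← Complex.exp_sum, ← Complex.exp_add]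
  congr 1
  push_cast
  rw [Finset.mul_sum, ← Finset.sum_add_distrib]
  refine Finset.sum_congr rfl fun i _ => ?_
  ring

theorem summable_norm_gaussPhase {τ : ℂ} (hτ : 0 < τ.im) :
    Summable fun m : Fin d → ℤ => ‖gaussPhase τ m‖ := by
  have h := (summable_norm_and_tsum_pi_prod (d := d) (fun _ k => jacobiTheta₂_term k (-(0 : ℝ)) τ)
    fun _ => ((summable_jacobiTheta₂_term_iff _ τ).2 hτ).norm).1
  refine h.congr fun m => ?_
  rw [← gaussPhase_mul_mFourier τ m fun _ => 0, norm_mul, norm_mFourier_apply, mul_one]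

theorem torusTheta_coe {τ : ℂ} (hτ : 0 < τ.im) (β : Fin d → ℝ) :
    torusTheta τ (fun i => (β i : UnitAddCircle)) = ∏ i, jacobiTheta₂ (β i) τ := by
  simp_rw [torusTheta, gaussPhase_mul_mFourier, ← jacobiTheta₂_neg_left (β _)]
  exact (summable_norm_and_tsum_pi_prod (fun i k => jacobiTheta₂_term k (-β i) τ)
    fun i => ((summable_jacobiTheta₂_term_iff _ τ).2 hτ).norm).2

theorem norm_torusTheta_le {τ : ℂ} (hτ : 0 < τ.im) (α : UnitAddTorus (Fin d)) :
    ‖torusTheta τ α‖ ≤ ∑' m : Fin d → ℤ, ‖gaussPhase τ m‖ :=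
  tsum_of_norm_bounded (summable_norm_gaussPhase hτ).hasSum fun m => by
    rw [norm_mul, norm_mFourier_apply, mul_one]

theorem continuous_torusTheta_horocycle {ε : ℝ} (hε : 0 < ε) :
    Continuous fun p : ℝ × UnitAddTorus (Fin d) => torusTheta (horocycle ε p.1) p.2 := by
  have hτ : 0 < (horocycle ε 0).im := by rw [horocycle_im]; positivity
  refine continuous_tsum (fun m => ?_) (summable_norm_gaussPhase hτ) fun m p => ?_
  · exact ((continuous_gaussPhase_horocycle ε m).comp continuous_fst).mul
      ((UnitAddTorus.mFourier (-m)).continuous.comp continuous_snd)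
  · rw [norm_mul, norm_gaussPhase_horocycle, norm_mFourier_apply, mul_one]

theorem continuous_torusTheta {τ : ℂ} (hτ : 0 < τ.im) :
    Continuous (torusTheta τ : UnitAddTorus (Fin d) → ℂ) :=
  continuous_tsum (fun m => continuous_const.mul (UnitAddTorus.mFourier (-m)).continuous)
    (summable_norm_gaussPhase hτ) fun m α => by rw [norm_mul, norm_mFourier_apply, mul_one]

theorem continuous_gaussConv_horocycle {ε : ℝ} (hε : 0 < ε) (f : lp (fun _ : Fin d → ℤ => ℂ) 2)
    (n : Fin d → ℤ) : Continuous fun t => gaussConv (horocycle ε t) f n := by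
  have hτ : 0 < (horocycle ε 0).im := by rw [horocycle_im]; positivity
  refine continuous_tsum (fun m => (continuous_gaussPhase_horocycle ε m).mul continuous_const)
    ((summable_norm_gaussPhase hτ).mul_right ‖f‖) fun m t => ?_
  rw [norm_mul, norm_gaussPhase_horocycle]
  gcongr
  exact lp.norm_apply_le_norm two_ne_zero f _

end Multiplier

section CircleMethod

variable {d : ℕ}

theorem norm_exp_neg_horocycle_mul (ε t : ℝ) (N : ℕ) :
    ‖Complex.exp (-(π * I * horocycle ε t * N))‖ = Real.exp (2 * π * ε * N) := by
  have hsplit : -(π * I * horocycle ε t * N) =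
      (2 * π * ε * N : ℝ) + (-(2 * π * t * N) : ℝ) * I := by
    rw [horocycle]
    push_cast
    linear_combination (-2 * π * ε * N) * Complex.I_sq
  rw [hsplit, Complex.exp_add, norm_mul, Complex.norm_exp_ofReal_mul_I, mul_one,
    ← Complex.ofReal_exp, Complex.norm_of_nonneg (Real.exp_nonneg _)]

theorem integral_exp_mul_gaussPhase (ε : ℝ) (N : ℕ) (m : Fin d → ℤ) :
    ∫ t in Set.Ioc (0 : ℝ) 1, Complex.exp (-(π * I * horocycle ε t * N)) *
      gaussPhase (horocycle ε t) m = if m ∈ sphere d √N then 1 else 0 := by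
  have hexp (t : ℝ) : Complex.exp (-(π * I * horocycle ε t * N)) * gaussPhase (horocycle ε t) m =
      Complex.exp (π * I * horocycle ε t * (∑ i, m i ^ 2 - N : ℤ)) := by
    rw [gaussPhase, ← Complex.exp_add]
    congr 1
    push_cast
    ring
  simp_rw [hexp, integral_exp_horocycle, mem_sphere_sqrt, sub_eq_zero]

theorem sum_sphere_eq_integral {ε : ℝ} (hε : 0 < ε) (f : lp (fun _ : Fin d → ℤ => ℂ) 2)
    (n : Fin d → ℤ) (N : ℕ) :
    ∑ m ∈ sphere d √N, f (n - m) = ∫ t in Set.Ioc (0 : ℝ) 1,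
      Complex.exp (-(π * I * horocycle ε t * N)) * gaussConv (horocycle ε t) f n := by
  let F (m : Fin d → ℤ) (t : ℝ) : ℂ := Complex.exp (-(π * I * horocycle ε t * N)) *
    (gaussPhase (horocycle ε t) m * f (n - m))
  have hF (m : Fin d → ℤ) : Continuous (F m) := by
    have := continuous_gaussPhase_horocycle ε m
    have := continuous_horocycle ε
    fun_prop
  have hnorm (m : Fin d → ℤ) : ∫ t in Set.Ioc (0 : ℝ) 1, ‖F m t‖ =
      Real.exp (2 * π * ε * N) * (‖gaussPhase (horocycle ε 0) m‖ * ‖f (n - m)‖) := by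
    simp [F, norm_exp_neg_horocycle_mul, norm_gaussPhase_horocycle ε]
  have hτ : 0 < (horocycle ε 0).im := by rw [horocycle_im]; positivity
  have hsum : Summable fun m => ∫ t in Set.Ioc (0 : ℝ) 1, ‖F m t‖ := by
    simp_rw [hnorm]
    refine .of_nonneg_of_le (fun m => by positivity) (fun m => ?_)
      (((summable_norm_gaussPhase hτ).mul_right ‖f‖).mul_left (Real.exp (2 * π * ε * N)))
    gcongr
    exact lp.norm_apply_le_norm two_ne_zero f _
  have hint (m : Fin d → ℤ) :
      ∫ t in Set.Ioc (0 : ℝ) 1, F m t = if m ∈ sphere d √N then f (n - m) else 0 := by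
    simp_rw [F, ← mul_assoc, integral_mul_const, integral_exp_mul_gaussPhase, ite_mul, one_mul,
      zero_mul]
  have h := integral_tsum_of_summable_integral_norm
    (fun m => (hF m).integrableOn_Icc.mono_set Set.Ioc_subset_Icc_self) hsum
  simp_rw [hint, F, tsum_mul_left] at h
  rw [tsum_eq_sum (s := sphere d √N) fun m hm => if_neg hm] at h
  exact (Finset.sum_congr rfl fun m hm => (if_pos hm).symm).trans h

theorem enorm_sum_sphere_le {ε : ℝ} (hε : 0 < ε) (f : lp (fun _ : Fin d → ℤ => ℂ) 2)
    (n : Fin d → ℤ) (N : ℕ) :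
    ‖∑ m ∈ sphere d √N, f (n - m)‖ₑ ≤ ENNReal.ofReal (Real.exp (2 * π * ε * N)) *
      ∫⁻ t in Set.Ioc (0 : ℝ) 1, ‖gaussConv (horocycle ε t) f n‖ₑ := by
  rw [sum_sphere_eq_integral hε, ← lintegral_const_mul' _ _ ENNReal.ofReal_ne_top]
  refine (enorm_integral_le_lintegral_enorm _).trans_eq (lintegral_congr fun t => ?_)
  rw [enorm_mul, ← ofReal_norm (Complex.exp _), norm_exp_neg_horocycle_mul]

end CircleMethod

section Parseval

open UnitAddTorus (mFourier mFourierCoeff)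

variable {d : ℕ}

theorem tsum_enorm_sq_mFourierCoeff (h : Lp ℂ 2 (torusMeasure d)) :
    ∑' n : Fin d → ℤ, ‖mFourierCoeff h n‖ₑ ^ 2 = ∫⁻ α, ‖h α‖ₑ ^ 2 ∂torusMeasure d := by
  have hs : HasSum (fun n => ‖mFourierCoeff h n‖ ^ 2) (∫ α, ‖h α‖ ^ 2 ∂torusMeasure d) :=
    UnitAddTorus.hasSum_sq_mFourierCoeff h
  have hint : Integrable (fun α => ‖h α‖ ^ 2) (torusMeasure d) :=
    (memLp_two_iff_integrable_sq_norm (Lp.aestronglyMeasurable h)).1 (Lp.memLp h)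
  simp_rw [← ofReal_norm, ← ENNReal.ofReal_pow (norm_nonneg _)]
  rw [← ofReal_integral_eq_lintegral_ofReal hint (.of_forall fun _ => by positivity), ← hs.tsum_eq,
    ENNReal.ofReal_tsum_of_nonneg (fun _ => by positivity) hs.summable]

theorem mFourierCoeff_fourierTransform (f : lp (fun _ : Fin d → ℤ => ℂ) 2) (n : Fin d → ℤ) :
    mFourierCoeff (fourierTransform f) (-n) = f n := by
  have hterm (m : Fin d → ℤ) :
      innerSL ℂ (char n) (f m • char m) = if m = n then f n else 0 := by
    rw [map_smul, innerSL_apply_apply, orthonormal_iff_ite.1 (char_orthonormal d)]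
    split_ifs <;> simp_all
  have hsum := (hasSum_fourierTransform f).mapL (innerSL ℂ (char n))
  simp_rw [hterm] at hsum
  rw [← hsum.unique (hasSum_ite_eq n (f n)), innerSL_apply_apply]
  refine (UnitAddTorus.mFourierBasis_repr (fourierTransform f) (-n)).symm.trans ?_
  rw [HilbertBasis.repr_apply_apply, UnitAddTorus.coe_mFourierBasis]
  rfl

theorem tsum_enorm_sq_eq_lintegral_fourierTransform (f : lp (fun _ : Fin d → ℤ => ℂ) 2) :
    ∑' n, ‖f n‖ₑ ^ 2 = ∫⁻ α, ‖fourierTransform f α‖ₑ ^ 2 ∂torusMeasure d := by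
  rw [← tsum_enorm_sq_mFourierCoeff,
    ← (Equiv.neg _).tsum_eq fun n => ‖mFourierCoeff (fourierTransform f) n‖ₑ ^ 2]
  exact tsum_congr fun n => by rw [Equiv.neg_apply, mFourierCoeff_fourierTransform]

theorem mFourierCoeff_torusTheta_mul {τ : ℂ} (hτ : 0 < τ.im) (f : lp (fun _ : Fin d → ℤ => ℂ) 2)
    (n : Fin d → ℤ) :
    mFourierCoeff (fun α => torusTheta τ α * fourierTransform f α) (-n) = gaussConv τ f n := by
  have hf : Integrable (fourierTransform f) (torusMeasure d) :=
    (Lp.memLp (fourierTransform f)).integrable one_le_two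
  have hint (k : Fin d → ℤ) :
      Integrable (fun α => mFourier (- -k) α * fourierTransform f α) (torusMeasure d) :=
    hf.bdd_mul (mFourier (- -k)).continuous.aestronglyMeasurable
      (.of_forall fun α => (norm_mFourier_apply _ α).le)
  have h := integral_tsum_of_summable_integral_norm (μ := torusMeasure d)
    (F := fun (m : Fin d → ℤ) α =>
      gaussPhase τ m * (mFourier (- -(n - m)) α * fourierTransform f α))
    (fun m => (hint _).const_mul _) (by
      simp_rw [norm_mul, norm_mFourier_apply, one_mul, integral_const_mul]
      exact (summable_norm_gaussPhase hτ).mul_right _)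
  have hcoeff (m : Fin d → ℤ) :
      ∫ α, mFourier (- -(n - m)) α * fourierTransform f α ∂torusMeasure d = f (n - m) :=
    mFourierCoeff_fourierTransform f (n - m)
  simp_rw [integral_const_mul, hcoeff] at h
  refine Eq.trans (integral_congr_ae (.of_forall fun α => ?_)) h.symm
  simp only [smul_eq_mul, neg_neg]
  rw [torusTheta, mul_left_comm, ← tsum_mul_right]
  refine tsum_congr fun m => ?_
  rw [sub_eq_add_neg, UnitAddTorus.mFourier_add]
  ring

theorem tsum_enorm_sq_gaussConv {τ : ℂ} (hτ : 0 < τ.im) (f : lp (fun _ : Fin d → ℤ => ℂ) 2) :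
    ∑' n, ‖gaussConv τ f n‖ₑ ^ 2 =
      ∫⁻ α, ‖torusTheta τ α‖ₑ ^ 2 * ‖fourierTransform f α‖ₑ ^ 2 ∂torusMeasure d := by
  have hbdd : MemLp (torusTheta τ) ∞ (torusMeasure d) :=
    memLp_top_of_bound (continuous_torusTheta hτ).aestronglyMeasurable _
      (.of_forall (norm_torusTheta_le hτ))
  have hmem : MemLp (fun α => torusTheta τ α * fourierTransform f α) 2 (torusMeasure d) :=
    (Lp.memLp (fourierTransform f)).mul' hbdd
  have hcoeff (n : Fin d → ℤ) : mFourierCoeff (hmem.toLp _) (-n) = gaussConv τ f n := by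
    rw [← mFourierCoeff_torusTheta_mul hτ]
    refine integral_congr_ae ?_
    filter_upwards [hmem.coeFn_toLp] with α hα
    rw [hα]
  simp_rw [← hcoeff]
  refine ((Equiv.neg _).tsum_eq fun n => ‖mFourierCoeff (hmem.toLp _) n‖ₑ ^ 2).trans ?_
  rw [tsum_enorm_sq_mFourierCoeff]
  refine lintegral_congr_ae ?_
  filter_upwards [hmem.coeFn_toLp] with α hα
  rw [hα, enorm_mul, mul_pow]

end Parseval

theorem sq_lintegral_le_weighted {X : Type*} [MeasurableSpace X] {μ : Measure X} {W g : X → ℝ≥0∞}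
    (hW : AEMeasurable W μ) (hg : AEMeasurable g μ) (h0 : ∀ᵐ x ∂μ, W x ≠ 0)
    (htop : ∀ᵐ x ∂μ, W x ≠ ∞) :
    (∫⁻ x, g x ∂μ) ^ 2 ≤ (∫⁻ x, W x ∂μ) * ∫⁻ x, (W x)⁻¹ * g x ^ 2 ∂μ := by
  have hsq (y : ℝ≥0∞) : (y ^ (1 / 2 : ℝ)) ^ (2 : ℝ) = y := by
    rw [← ENNReal.rpow_mul]
    norm_num
  have hsplit : ∫⁻ x, g x ∂μ = ∫⁻ x, W x ^ (1 / 2 : ℝ) * ((W x)⁻¹ ^ (1 / 2 : ℝ) * g x) ∂μ := by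
    refine lintegral_congr_ae ?_
    filter_upwards [h0, htop] with x hx0 hxt
    rw [← mul_assoc, ← ENNReal.mul_rpow_of_nonneg _ _ (by norm_num),
      ENNReal.mul_inv_cancel hx0 hxt, ENNReal.one_rpow, one_mul]
  have hcs := ENNReal.lintegral_mul_le_Lp_mul_Lq μ Real.HolderConjugate.two_two
    (hW.pow_const (1 / 2 : ℝ)) ((hW.inv.pow_const (1 / 2 : ℝ)).mul hg)
  simp only [Pi.mul_apply, Pi.inv_apply, ENNReal.mul_rpow_of_nonneg _ _ zero_le_two, hsq] at hcs
  rw [← hsplit] at hcs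
  simp_rw [← ENNReal.rpow_two]
  refine (ENNReal.rpow_le_rpow hcs zero_le_two).trans_eq ?_
  rw [ENNReal.mul_rpow_of_nonneg _ _ zero_le_two, hsq, hsq]

section WeightedBound

variable {d : ℕ} {ε : ℝ} (hε : 0 < ε) (f : lp (fun _ : Fin d → ℤ => ℂ) 2) {W : ℝ → ℝ≥0∞}
  (hW : Measurable W)

include hε hW

theorem lintegral_inv_mul_tsum_gaussConv :
    ∫⁻ t in Set.Ioc (0 : ℝ) 1, (W t)⁻¹ * ∑' n, ‖gaussConv (horocycle ε t) f n‖ₑ ^ 2 =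
      ∫⁻ α, (∫⁻ t in Set.Ioc (0 : ℝ) 1, (W t)⁻¹ * ‖torusTheta (horocycle ε t) α‖ₑ ^ 2) *
        ‖fourierTransform f α‖ₑ ^ 2 ∂torusMeasure d := by
  have hτ (t : ℝ) : 0 < (horocycle ε t).im := by rw [horocycle_im]; positivity
  have hΘ := (continuous_torusTheta_horocycle (d := d) hε).measurable.enorm.pow_const 2
  have hf : AEMeasurable (fun α => ‖fourierTransform f α‖ₑ ^ 2) (torusMeasure d) :=
    (Lp.aestronglyMeasurable (fourierTransform f)).aemeasurable.enorm.pow_const 2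
  have hjoint : AEMeasurable (Function.uncurry fun (t : ℝ) (α : UnitAddTorus (Fin d)) =>
      (W t)⁻¹ * (‖torusTheta (horocycle ε t) α‖ₑ ^ 2 * ‖fourierTransform f α‖ₑ ^ 2))
      ((volume.restrict (Set.Ioc (0 : ℝ) 1)).prod (torusMeasure d)) :=
    (hW.inv.comp measurable_fst).aemeasurable.mul (hΘ.aemeasurable.mul hf.comp_snd)
  calc _ = ∫⁻ t in Set.Ioc (0 : ℝ) 1, ∫⁻ α, (W t)⁻¹ * (‖torusTheta (horocycle ε t) α‖ₑ ^ 2 *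
        ‖fourierTransform f α‖ₑ ^ 2) ∂torusMeasure d := by
        refine lintegral_congr fun t => ?_
        rw [tsum_enorm_sq_gaussConv (hτ t), lintegral_const_mul'']
        exact ((continuous_torusTheta (hτ t)).measurable.enorm.pow_const 2).aemeasurable.mul hf
    _ = ∫⁻ α, (∫⁻ t in Set.Ioc (0 : ℝ) 1, (W t)⁻¹ * (‖torusTheta (horocycle ε t) α‖ₑ ^ 2 *
        ‖fourierTransform f α‖ₑ ^ 2)) ∂torusMeasure d := lintegral_lintegral_swap hjoint
    _ = _ := by
        simp_rw [← mul_assoc]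
        exact lintegral_congr fun α => lintegral_mul_const' _ _ (by finiteness)

theorem tsum_sq_lintegral_gaussConv_le (h0 : ∀ t ∈ Set.Ioc (0 : ℝ) 1, W t ≠ 0)
    (htop : ∀ t, W t ≠ ∞) {B : ℝ≥0∞}
    (hB : ∀ᵐ α ∂torusMeasure d, fourierTransform f α ≠ 0 →
      ∫⁻ t in Set.Ioc (0 : ℝ) 1, (W t)⁻¹ * ‖torusTheta (horocycle ε t) α‖ₑ ^ 2 ≤ B) :
    ∑' n, (∫⁻ t in Set.Ioc (0 : ℝ) 1, ‖gaussConv (horocycle ε t) f n‖ₑ) ^ 2 ≤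
      (∫⁻ t in Set.Ioc (0 : ℝ) 1, W t) * (B * ∑' n, ‖f n‖ₑ ^ 2) := by
  have hconv (n : Fin d → ℤ) : Measurable fun t => ‖gaussConv (horocycle ε t) f n‖ₑ :=
    (continuous_gaussConv_horocycle hε f n).measurable.enorm
  calc ∑' n, (∫⁻ t in Set.Ioc (0 : ℝ) 1, ‖gaussConv (horocycle ε t) f n‖ₑ) ^ 2
      ≤ ∑' n, (∫⁻ t in Set.Ioc (0 : ℝ) 1, W t) *
          ∫⁻ t in Set.Ioc (0 : ℝ) 1, (W t)⁻¹ * ‖gaussConv (horocycle ε t) f n‖ₑ ^ 2 :=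
        ENNReal.tsum_le_tsum fun n => sq_lintegral_le_weighted hW.aemeasurable
          (hconv n).aemeasurable (ae_restrict_of_forall_mem measurableSet_Ioc h0)
          (.of_forall htop)
    _ = (∫⁻ t in Set.Ioc (0 : ℝ) 1, W t) * ∫⁻ t in Set.Ioc (0 : ℝ) 1,
          (W t)⁻¹ * ∑' n, ‖gaussConv (horocycle ε t) f n‖ₑ ^ 2 := by
        have hmeas (n : Fin d → ℤ) : AEMeasurable (fun t =>
            (W t)⁻¹ * ‖gaussConv (horocycle ε t) f n‖ₑ ^ 2) (volume.restrict (Set.Ioc 0 1)) :=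
          (hW.inv.mul ((hconv n).pow_const 2)).aemeasurable
        rw [ENNReal.tsum_mul_left, ← lintegral_tsum hmeas]
        simp_rw [ENNReal.tsum_mul_left]
    _ ≤ (∫⁻ t in Set.Ioc (0 : ℝ) 1, W t) *
          ∫⁻ α, B * ‖fourierTransform f α‖ₑ ^ 2 ∂torusMeasure d := by
        rw [lintegral_inv_mul_tsum_gaussConv hε f hW]
        gcongr 1
        refine lintegral_mono_ae ?_
        filter_upwards [hB] with α hα
        by_cases h : fourierTransform f α = 0
        · simp [h]
        · gcongr
          exact hα h
    _ = _ := by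
        rw [lintegral_const_mul'' _ ((Lp.aestronglyMeasurable
          (fourierTransform f)).aemeasurable.enorm.pow_const 2),
          tsum_enorm_sq_eq_lintegral_fourierTransform]

end WeightedBound

section Arcs

/-- The convergent integral `∫ (1 + x²)^(-5/8)`, the decay left on each arc after the Gaussian
factor has been spent. -/
def decayIntegral : ℝ := ∫ x : ℝ, (1 + ‖x‖ ^ 2) ^ (-(5 / 4 : ℝ) / 2)

theorem decayIntegral_nonneg : 0 ≤ decayIntegral :=
  integral_nonneg fun _ => by positivity

theorem norm_sq_horocycle (ε s : ℝ) : ‖horocycle ε s‖ ^ 2 = 4 * (ε ^ 2 + s ^ 2) := by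
  rw [horocycle, norm_mul, mul_pow, Complex.sq_norm (s + ε * I), Complex.normSq_add_mul_I]
  norm_num
  ring

theorem norm_horocycle_pos {ε : ℝ} (hε : 0 < ε) (s : ℝ) : 0 < ‖horocycle ε s‖ :=
  norm_pos_iff.2 fun h => by simpa [h, hε.ne'] using horocycle_im ε s

theorem rpow_norm_horocycle_le {ε p : ℝ} (hε : 0 < ε) (hp : 5 / 4 ≤ p) (s : ℝ) :
    ‖horocycle ε s‖ ^ (-p) ≤ ε ^ (-p) * (1 + ‖ε⁻¹ * s‖ ^ 2) ^ (-(5 / 4 : ℝ) / 2) := by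
  have hone : 1 ≤ 1 + ‖ε⁻¹ * s‖ ^ 2 := le_add_of_nonneg_right (sq_nonneg _)
  have hlow : ε * (1 + ‖ε⁻¹ * s‖ ^ 2) ^ (1 / 2 : ℝ) ≤ ‖horocycle ε s‖ := by
    rw [← Real.sqrt_eq_rpow]
    refine le_of_sq_le_sq ?_ (norm_nonneg _)
    rw [mul_pow, Real.sq_sqrt (by positivity), norm_sq_horocycle, Real.norm_eq_abs, sq_abs]
    field_simp
    nlinarith [sq_nonneg ε, sq_nonneg s]
  calc ‖horocycle ε s‖ ^ (-p) ≤ (ε * (1 + ‖ε⁻¹ * s‖ ^ 2) ^ (1 / 2 : ℝ)) ^ (-p) :=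
        Real.rpow_le_rpow_of_nonpos (by positivity) hlow (by linarith)
    _ = ε ^ (-p) * (1 + ‖ε⁻¹ * s‖ ^ 2) ^ (1 / 2 * -p) := by
        rw [Real.mul_rpow hε.le (by positivity), ← Real.rpow_mul (by positivity)]
    _ ≤ _ := by
        gcongr
        linarith

theorem lintegral_rpow_norm_horocycle_le {ε p : ℝ} (hε : 0 < ε) (hp : 5 / 4 ≤ p) :
    ∫⁻ s : ℝ, ENNReal.ofReal (‖horocycle ε s‖ ^ (-p)) ≤
      ENNReal.ofReal (decayIntegral * ε ^ (1 - p)) := by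
  have hint : Integrable fun x : ℝ => (1 + ‖x‖ ^ 2) ^ (-(5 / 4 : ℝ) / 2) :=
    integrable_rpow_neg_one_add_norm_sq (by simp; norm_num)
  have hval : ∫ s : ℝ, ε ^ (-p) * (1 + ‖ε⁻¹ * s‖ ^ 2) ^ (-(5 / 4 : ℝ) / 2) =
      decayIntegral * ε ^ (1 - p) := by
    rw [integral_const_mul, Measure.integral_comp_mul_left
      (fun x : ℝ => (1 + ‖x‖ ^ 2) ^ (-(5 / 4 : ℝ) / 2)), inv_inv, abs_of_pos hε, smul_eq_mul,
      sub_eq_neg_add, Real.rpow_add hε, Real.rpow_one, decayIntegral]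
    ring
  rw [← hval, ofReal_integral_eq_lintegral_ofReal
    ((hint.comp_mul_left' (inv_ne_zero hε.ne')).const_mul _) (.of_forall fun s => by positivity)]
  exact lintegral_mono fun s => ENNReal.ofReal_le_ofReal (rpow_norm_horocycle_le hε hp s)

/-- The size of the theta function of `ℤ^d` at horizontal distance `s` from a reduced fraction with
denominator `q`. -/
def arcWeight (d : ℕ) (ε : ℝ) (q : ℕ) (s : ℝ) : ℝ :=
  (q * ‖horocycle ε s‖) ^ (-(d : ℝ) / 2)

theorem arcWeight_pos {q : ℕ} {ε : ℝ} (d : ℕ) (hε : 0 < ε) (hq : 1 ≤ q) (s : ℝ) :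
    0 < arcWeight d ε q s := by
  have := norm_horocycle_pos hε s
  unfold arcWeight
  positivity

theorem measurable_arcWeight (d : ℕ) (ε : ℝ) (q : ℕ) : Measurable (arcWeight d ε q) := by
  have := (continuous_horocycle ε).measurable
  unfold arcWeight
  fun_prop

theorem arcWeight_sq (d : ℕ) (ε : ℝ) (q : ℕ) (s : ℝ) :
    arcWeight d ε q s ^ 2 = ((q * ‖horocycle ε s‖)⁻¹) ^ d := by
  rw [arcWeight, ← Real.rpow_mul_natCast (by positivity), inv_pow, ← Real.rpow_natCast,
    ← Real.rpow_neg (by positivity)]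
  congr 1
  push_cast
  ring

theorem arcWeight_le {d q : ℕ} (hd : 5 ≤ d) (hq : 1 ≤ q) (ε s : ℝ) :
    arcWeight d ε q s ≤ (q : ℝ) ^ (-(5 / 2) : ℝ) * ‖horocycle ε s‖ ^ (-((d : ℝ) / 2)) := by
  have hd' : (5 : ℝ) ≤ d := by exact_mod_cast hd
  rw [arcWeight, Real.mul_rpow (by positivity) (by positivity), neg_div]
  gcongr ?_ * _
  exact Real.rpow_le_rpow_of_exponent_le (by exact_mod_cast hq) (by linarith)

theorem lintegral_ofReal_le_of_le_rpow_norm_horocycle {g : ℝ → ℝ} {A ε p : ℝ} (hA : 0 ≤ A)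
    (hε : 0 < ε) (hp : 5 / 4 ≤ p) (hg : ∀ s, g s ≤ A * ‖horocycle ε s‖ ^ (-p)) :
    ∫⁻ s, ENNReal.ofReal (g s) ≤ ENNReal.ofReal (A * (decayIntegral * ε ^ (1 - p))) := by
  calc ∫⁻ s, ENNReal.ofReal (g s)
      ≤ ∫⁻ s, ENNReal.ofReal A * ENNReal.ofReal (‖horocycle ε s‖ ^ (-p)) :=
        lintegral_mono fun s => by
          rw [← ENNReal.ofReal_mul hA]
          exact ENNReal.ofReal_le_ofReal (hg s)
    _ ≤ ENNReal.ofReal (A * (decayIntegral * ε ^ (1 - p))) := by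
        rw [lintegral_const_mul' _ _ ENNReal.ofReal_ne_top, ENNReal.ofReal_mul hA]
        gcongr
        exact lintegral_rpow_norm_horocycle_le hε hp

theorem lintegral_arcWeight_le {d q : ℕ} (hd : 5 ≤ d) (hq : 1 ≤ q) {ε : ℝ} (hε : 0 < ε) :
    ∫⁻ s, ENNReal.ofReal (arcWeight d ε q s) ≤
      ENNReal.ofReal (decayIntegral * ε ^ (1 - (d : ℝ) / 2) * (q : ℝ) ^ (-(5 / 2) : ℝ)) := by
  have hd' : (5 : ℝ) ≤ d := by exact_mod_cast hd
  rw [mul_comm]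
  exact lintegral_ofReal_le_of_le_rpow_norm_horocycle (by positivity) hε (by linarith)
    (arcWeight_le hd hq ε)

theorem exp_neg_le_rpow {x : ℝ} (hx : 0 < x) : Real.exp (-x) ≤ x ^ (-(5 / 8) : ℝ) := by
  rw [Real.exp_neg, Real.rpow_neg hx.le]
  refine inv_anti₀ (by positivity) ?_
  rcases le_total x 1 with h | h
  · exact (Real.rpow_le_one hx.le h (by norm_num)).trans (Real.one_le_exp hx.le)
  · calc x ^ (5 / 8 : ℝ) ≤ x := Real.rpow_le_self_of_one_le h (by norm_num)
      _ ≤ Real.exp x := by linarith [Real.add_one_le_exp x]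

theorem exp_neg_horocycle_le {ε Y : ℝ} (hε : 0 < ε) (hY : 0 < Y) (s : ℝ) :
    Real.exp (-(π * (2 * ε / ‖horocycle ε s‖ ^ 2) * (ε * Y))) ≤
      Y ^ (-(5 / 8) : ℝ) * ε ^ (-(5 / 4) : ℝ) * ‖horocycle ε s‖ ^ (5 / 4 : ℝ) := by
  have hr := norm_horocycle_pos hε s
  generalize ‖horocycle ε s‖ = r at hr ⊢
  have hle : Y * ε ^ (2 : ℝ) * r ^ (-2 : ℝ) ≤ π * (2 * ε / r ^ 2) * (ε * Y) := by
    rw [Real.rpow_two, Real.rpow_neg hr.le, Real.rpow_two]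
    calc Y * ε ^ 2 * (r ^ 2)⁻¹ ≤ 2 * π * (Y * ε ^ 2 * (r ^ 2)⁻¹) :=
          le_mul_of_one_le_left (by positivity) (by linarith [Real.pi_gt_three])
      _ = _ := by ring
  calc Real.exp (-(π * (2 * ε / r ^ 2) * (ε * Y)))
      ≤ Real.exp (-(Y * ε ^ (2 : ℝ) * r ^ (-2 : ℝ))) := by gcongr
    _ ≤ (Y * ε ^ (2 : ℝ) * r ^ (-2 : ℝ)) ^ (-(5 / 8) : ℝ) := exp_neg_le_rpow (by positivity)
    _ = _ := by
        rw [Real.mul_rpow (by positivity) (by positivity), Real.mul_rpow hY.le (by positivity),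
          ← Real.rpow_mul hε.le, ← Real.rpow_mul hr.le]
        norm_num

theorem lintegral_arcWeight_mul_exp_le {d q : ℕ} (hd : 5 ≤ d) (hq : 1 ≤ q) {ε Y : ℝ} (hε : 0 < ε)
    (hY : 0 < Y) :
    ∫⁻ s, ENNReal.ofReal (arcWeight d ε q s *
      Real.exp (-(π * (2 * ε / ‖horocycle ε s‖ ^ 2) * (ε * Y)))) ≤
      ENNReal.ofReal (decayIntegral * ε ^ (1 - (d : ℝ) / 2) * (q : ℝ) ^ (-(5 / 2) : ℝ) *
        Y ^ (-(5 / 8) : ℝ)) := by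
  have hd' : (5 : ℝ) ≤ d := by exact_mod_cast hd
  have hpt (s : ℝ) : arcWeight d ε q s *
      Real.exp (-(π * (2 * ε / ‖horocycle ε s‖ ^ 2) * (ε * Y))) ≤
      (q : ℝ) ^ (-(5 / 2) : ℝ) * Y ^ (-(5 / 8) : ℝ) * ε ^ (-(5 / 4) : ℝ) *
        ‖horocycle ε s‖ ^ (-((d : ℝ) / 2 - 5 / 4)) := by
    refine (mul_le_mul (arcWeight_le hd hq ε s) (exp_neg_horocycle_le hε hY s)
      (Real.exp_nonneg _) (by positivity)).trans_eq ?_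
    rw [neg_sub, sub_eq_neg_add, Real.rpow_add (norm_horocycle_pos hε s)]
    ring
  refine (lintegral_ofReal_le_of_le_rpow_norm_horocycle (by positivity) hε (by linarith)
    hpt).trans_eq ?_
  rw [show 1 - ((d : ℝ) / 2 - 5 / 4) = 1 - (d : ℝ) / 2 - -(5 / 4) by ring, Real.rpow_sub hε]
  field_simp

end Arcs

section Farey

/-- Numerators of the reduced fractions in `[0, 1]` with denominator `q`. -/
def numerators (q : ℕ) : Finset ℕ := {a ∈ Finset.range (q + 1) | q.Coprime a}

theorem card_numerators_le (q : ℕ) : (numerators q).card ≤ q + 1 :=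
  (Finset.card_filter_le _ _).trans (Finset.card_range _).le

theorem exists_farey_arc {Q : ℕ} (hQ : 0 < Q) {t : ℝ} (ht : t ∈ Set.Icc (0 : ℝ) 1) :
    ∃ q ∈ Finset.Icc 1 Q, ∃ a ∈ numerators q, |t - a / q| ≤ 1 / (q * Q) := by
  obtain ⟨r, hr, hden⟩ := Real.exists_rat_abs_sub_le_and_den_le t hQ
  have hd : (0 : ℝ) < r.den := by exact_mod_cast r.den_pos
  rw [Rat.cast_def] at hr
  have hmul : |t * r.den - r.num| < 1 := by
    calc |t * r.den - r.num| = |t - r.num / r.den| * r.den := by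
          rw [← abs_of_pos hd, ← abs_mul, abs_of_pos hd, sub_mul, div_mul_cancel₀ _ hd.ne']
      _ ≤ 1 / ((Q + 1) * r.den) * r.den := by gcongr
      _ = 1 / (Q + 1) := by field_simp
      _ < 1 := (div_lt_one (by positivity)).2 (by simpa using hQ)
  have htd : 0 ≤ t * r.den ∧ t * r.den ≤ r.den :=
    ⟨mul_nonneg ht.1 hd.le, mul_le_of_le_one_left hd.le ht.2⟩
  rw [abs_lt] at hmul
  have hnum : 0 ≤ r.num := by
    rw [← Int.lt_add_one_iff]
    exact_mod_cast (by linarith : (0 : ℝ) < r.num + 1)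
  have hnum' : r.num ≤ r.den := by
    rw [← Int.lt_add_one_iff]
    exact_mod_cast (by linarith : (r.num : ℝ) < r.den + 1)
  have hcop := r.reduced.symm
  obtain ⟨a, ha⟩ := Int.eq_ofNat_of_zero_le hnum
  rw [ha] at hr hnum' hcop
  refine ⟨r.den, Finset.mem_Icc.2 ⟨r.den_pos, hden⟩, a,
    Finset.mem_filter.2 ⟨Finset.mem_range.2 (by omega), hcop⟩, hr.trans ?_⟩
  rw [mul_comm]
  gcongr
  linarith

/-- The sum of the translates of `g q` to all reduced fractions in `[0, 1]` with denominator
`q ≤ Q`. -/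
def fareySum (Q : ℕ) (g : ℕ → ℝ → ℝ≥0∞) (t : ℝ) : ℝ≥0∞ :=
  ∑ q ∈ Finset.Icc 1 Q, ∑ a ∈ numerators q, g q (t - a / q)

theorem le_fareySum {q a Q : ℕ} (hq : q ∈ Finset.Icc 1 Q) (ha : a ∈ numerators q)
    (g : ℕ → ℝ → ℝ≥0∞) (t : ℝ) : g q (t - a / q) ≤ fareySum Q g t :=
  (Finset.single_le_sum (f := fun a : ℕ => g q (t - a / q)) (fun _ _ => zero_le) ha).trans
    (Finset.single_le_sum (f := fun q : ℕ => ∑ a ∈ numerators q, g q (t - a / q))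
      (fun _ _ => zero_le) hq)

theorem lintegral_fareySum_le (Q : ℕ) {g : ℕ → ℝ → ℝ≥0∞} (hg : ∀ q, Measurable (g q)) :
    ∫⁻ t, fareySum Q g t ≤ ∑ q ∈ Finset.Icc 1 Q, 2 * q * ∫⁻ s, g q s := by
  have hmeas (q a : ℕ) : Measurable fun t : ℝ => g q (t - a / q) := (hg q).comp (by fun_prop)
  simp_rw [fareySum]
  rw [lintegral_finsetSum _ fun q _ => Finset.measurable_sum _ fun a _ => hmeas q a]
  refine Finset.sum_le_sum fun q hq => ?_
  rw [lintegral_finsetSum _ fun a _ => hmeas q a]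
  simp_rw [lintegral_sub_right_eq_self]
  rw [Finset.sum_const, nsmul_eq_mul]
  gcongr
  have hcard : (numerators q).card ≤ 2 * q := by
    linarith [card_numerators_le q, (Finset.mem_Icc.1 hq).1]
  exact_mod_cast hcard

theorem lintegral_fareySum_ofReal_le (Q : ℕ) {g : ℕ → ℝ → ℝ} (hg : ∀ q, Measurable (g q))
    {K : ℝ} (hK : 0 ≤ K) {M : ℕ → ℝ} (hM : ∀ q, 0 ≤ M q)
    (h : ∀ q ∈ Finset.Icc 1 Q, ∫⁻ s, ENNReal.ofReal (g q s) ≤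
      ENNReal.ofReal (K * (q : ℝ) ^ (-(5 / 2) : ℝ) * M q)) :
    ∫⁻ t, fareySum Q (fun q s => ENNReal.ofReal (g q s)) t ≤
      ENNReal.ofReal (2 * K * ∑ q ∈ Finset.Icc 1 Q, (q : ℝ) ^ (-(3 / 2) : ℝ) * M q) := by
  refine (lintegral_fareySum_le Q fun q => (hg q).ennreal_ofReal).trans ?_
  rw [Finset.mul_sum, ENNReal.ofReal_sum_of_nonneg fun q _ =>
    mul_nonneg (by positivity) (mul_nonneg (by positivity) (hM q))]
  refine Finset.sum_le_sum fun q hq => ?_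
  have hq0 : (0 : ℝ) < q := by exact_mod_cast (Finset.mem_Icc.1 hq).1
  calc 2 * (q : ℝ≥0∞) * ∫⁻ s, ENNReal.ofReal (g q s)
      ≤ ENNReal.ofReal (2 * q) * ENNReal.ofReal (K * (q : ℝ) ^ (-(5 / 2) : ℝ) * M q) := by
        rw [ENNReal.ofReal_mul zero_le_two, ENNReal.ofReal_natCast, ENNReal.ofReal_ofNat]
        gcongr
        exact h q hq
    _ = _ := by
        rw [← ENNReal.ofReal_mul (by positivity),
          show (-(3 / 2) : ℝ) = -(5 / 2) + 1 by norm_num, Real.rpow_add hq0, Real.rpow_one]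
        ring_nf

end Farey

section SmallDenominators

/-- The convergent sum `∑ q^(-13/12)`. It bounds `∑ q^(-3/2)` and leaves the factor `T^(-5/12)` for
the tail `T ≤ q`. -/
def decaySum : ℝ := ∑' q : ℕ, (q : ℝ) ^ (-(13 / 12) : ℝ)

theorem sum_le_decaySum (S : Finset ℕ) : ∑ q ∈ S, (q : ℝ) ^ (-(13 / 12) : ℝ) ≤ decaySum :=
  (Real.summable_nat_rpow.2 (by norm_num)).sum_le_tsum S fun _ _ => by positivity

theorem decaySum_nonneg : 0 ≤ decaySum := tsum_nonneg fun _ => by positivity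

theorem sum_rpow_le_of_le {S : Finset ℕ} {T : ℝ} (hT : 0 < T) (hS : ∀ q ∈ S, T ≤ q) :
    ∑ q ∈ S, (q : ℝ) ^ (-(3 / 2) : ℝ) ≤ T ^ (-(5 / 12) : ℝ) * decaySum := by
  calc _ ≤ ∑ q ∈ S, T ^ (-(5 / 12) : ℝ) * (q : ℝ) ^ (-(13 / 12) : ℝ) := by
        refine Finset.sum_le_sum fun q hq => ?_
        rw [show (-(3 / 2) : ℝ) = -(5 / 12) + -(13 / 12) by norm_num,
          Real.rpow_add (hT.trans_le (hS q hq))]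
        gcongr ?_ * _
        exact Real.rpow_le_rpow_of_nonpos hT (hS q hq) (by norm_num)
    _ ≤ _ := by
        rw [← Finset.mul_sum]
        gcongr
        exact sum_le_decaySum S

theorem sum_rpow_le_decaySum {S : Finset ℕ} (hS : ∀ q ∈ S, 1 ≤ q) :
    ∑ q ∈ S, (q : ℝ) ^ (-(3 / 2) : ℝ) ≤ decaySum := by
  have h := sum_rpow_le_of_le one_pos fun q hq => Nat.one_le_cast.2 (hS q hq)
  rwa [Real.one_rpow, one_mul] at h

theorem sum_rpow_le_of_dvd {S : Finset ℕ} (hS : ∀ q ∈ S, 1 ≤ q) {s : ℕ} (hs : 0 < s)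
    (hdvd : ∀ q ∈ S, s ∣ q) :
    ∑ q ∈ S, (q : ℝ) ^ (-(3 / 2) : ℝ) ≤ (s : ℝ) ^ (-(3 / 2) : ℝ) * decaySum := by
  have hinj : Set.InjOn (fun q => q / s) (S : Set ℕ) := fun x hx y hy hxy =>
    (Nat.div_left_inj (hdvd x hx) (hdvd y hy)).1 hxy
  calc ∑ q ∈ S, (q : ℝ) ^ (-(3 / 2) : ℝ)
      = (s : ℝ) ^ (-(3 / 2) : ℝ) * ∑ u ∈ S.image (· / s), (u : ℝ) ^ (-(3 / 2) : ℝ) := by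
        rw [Finset.sum_image hinj, Finset.mul_sum]
        refine Finset.sum_congr rfl fun q hq => ?_
        rw [← Real.mul_rpow (by positivity) (by positivity), ← Nat.cast_mul,
          Nat.mul_div_cancel' (hdvd q hq)]
    _ ≤ _ := by
        gcongr
        refine sum_rpow_le_decaySum fun u hu => ?_
        obtain ⟨q, hq, rfl⟩ := Finset.mem_image.1 hu
        exact Nat.div_pos (Nat.le_of_dvd (hS q hq) (hdvd q hq)) hs

/-- `q` is the denominator of a fraction, not necessarily reduced, at distance less than `η` from
`x`. -/
def IsApproxDenominator (η x : ℝ) (q : ℕ) : Prop := ∃ l : ℤ, |x - l / q| < η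

theorem IsApproxDenominator.of_dvd {η x : ℝ} {s q : ℕ} (hq : q ≠ 0) (hsq : s ∣ q)
    (h : IsApproxDenominator η x s) : IsApproxDenominator η x q := by
  obtain ⟨l, hl⟩ := h
  obtain ⟨c, rfl⟩ := hsq
  refine ⟨l * c, ?_⟩
  have hc : (c : ℝ) ≠ 0 := by exact_mod_cast right_ne_zero_of_mul hq
  rwa [Int.cast_mul, Nat.cast_mul, Int.cast_natCast, mul_div_mul_right _ _ hc]

theorem rat_eq_of_abs_sub_lt {x η : ℝ} {R : ℕ} (hη : 2 * η * R ^ 2 ≤ 1) {ρ σ : ℚ}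
    (hρR : ρ.den ≤ R) (hσR : σ.den ≤ R) (hρ : |x - ρ| < η) (hσ : |x - σ| < η) : ρ = σ := by
  have hη0 : 0 < η := (abs_nonneg _).trans_lt hρ
  have hdist : |(ρ : ℝ) - σ| < 2 * η := by
    have := abs_sub_le (ρ : ℝ) x σ
    rw [abs_sub_comm (ρ : ℝ) x] at this
    linarith
  have hcross : ((ρ.num * σ.den - σ.num * ρ.den : ℤ) : ℝ) = (ρ - σ) * (ρ.den * σ.den) := by
    push_cast
    rw [Rat.cast_def ρ, Rat.cast_def σ]
    field_simp
  have hlt : |((ρ.num * σ.den - σ.num * ρ.den : ℤ) : ℝ)| < 1 := by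
    calc |((ρ.num * σ.den - σ.num * ρ.den : ℤ) : ℝ)| = |(ρ : ℝ) - σ| * (ρ.den * σ.den) := by
          rw [hcross, abs_mul, abs_of_pos (by positivity : (0 : ℝ) < ρ.den * σ.den)]
      _ < 2 * η * (ρ.den * σ.den) := by gcongr
      _ ≤ 2 * η * (R * R) := by gcongr
      _ ≤ 1 := by rwa [← sq]
  rw [Rat.eq_iff_mul_eq_mul, ← sub_eq_zero]
  exact Int.abs_lt_one_iff.1 (by exact_mod_cast hlt)

theorem exists_common_divisor {x η : ℝ} {P R : ℕ} (hη : 2 * η * R ^ 2 ≤ 1)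
    (hx : ∀ s, 1 ≤ s → s ≤ P → ¬IsApproxDenominator η x s) :
    ∃ s, P < s ∧ ∀ q, 1 ≤ q → q ≤ R → IsApproxDenominator η x q → s ∣ q := by
  have hden {q : ℕ} (l : ℤ) (hq : 1 ≤ q) (hqR : q ≤ R) :
      ((l / q : ℚ).den ∣ q) ∧ (l / q : ℚ).den ≤ R := by
    have hdvd : (l / q : ℚ).den ∣ q := by
      have h := Rat.den_dvd l q
      rw [Rat.divInt_eq_div, Int.cast_natCast] at h
      exact_mod_cast h
    exact ⟨hdvd, (Nat.le_of_dvd hq hdvd).trans hqR⟩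
  by_cases hex : ∃ q, 1 ≤ q ∧ q ≤ R ∧ IsApproxDenominator η x q
  · obtain ⟨q₀, hq₀, hq₀R, l₀, hl₀⟩ := hex
    set ρ : ℚ := l₀ / q₀ with hρ
    have hρx : |x - ρ| < η := by rwa [hρ, Rat.cast_div, Rat.cast_intCast, Rat.cast_natCast]
    refine ⟨ρ.den, lt_of_not_ge fun hP => hx ρ.den ρ.den_pos hP ⟨ρ.num, ?_⟩, ?_⟩
    · rwa [← Rat.cast_def]
    · rintro q hq hqR ⟨l, hl⟩
      have heq : ρ = l / q := rat_eq_of_abs_sub_lt hη (hden l₀ hq₀ hq₀R).2 (hden l hq hqR).2 hρx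
        (by rwa [Rat.cast_div, Rat.cast_intCast, Rat.cast_natCast])
      rw [heq]
      exact (hden l hq hqR).1
  · push Not at hex
    exact ⟨P + 1, P.lt_succ_self, fun q hq hqR h => absurd h (hex q hq hqR)⟩

open scoped Classical in
theorem sum_isApproxDenominator_le {x η : ℝ} {P R : ℕ} (hP : 0 < P) (hR : 0 < R)
    (hη : 2 * η * R ^ 2 ≤ 1) (hx : ∀ s, 1 ≤ s → s ≤ P → ¬IsApproxDenominator η x s) (Q : ℕ) :
    ∑ q ∈ Finset.Icc 1 Q with IsApproxDenominator η x q, (q : ℝ) ^ (-(3 / 2) : ℝ) ≤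
      ((P : ℝ) ^ (-(3 / 2) : ℝ) + (R : ℝ) ^ (-(5 / 12) : ℝ)) * decaySum := by
  obtain ⟨s, hPs, hdvd⟩ := exists_common_divisor hη hx
  rw [← Finset.sum_filter_add_sum_filter_not _ (· ≤ R), add_mul]
  gcongr ?_ + ?_
  · calc _ ≤ (s : ℝ) ^ (-(3 / 2) : ℝ) * decaySum := by
          refine sum_rpow_le_of_dvd ?_ (hP.trans hPs) ?_
          all_goals
            intro q hq
            simp only [Finset.mem_filter, Finset.mem_Icc] at hq
          · exact hq.1.1.1
          · exact hdvd q hq.1.1.1 hq.2 hq.1.2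
      _ ≤ _ := by
          refine mul_le_mul_of_nonneg_right ?_ decaySum_nonneg
          exact Real.rpow_le_rpow_of_nonpos (by positivity) (by exact_mod_cast hPs.le)
            (by norm_num)
  · refine sum_rpow_le_of_le (by positivity) fun q hq => ?_
    exact_mod_cast (not_le.1 (Finset.mem_filter.1 hq).2).le

theorem dvd_qLcm {j s : ℕ} (hs : 1 ≤ s) (hs' : s ≤ 2 ^ j) : s ∣ qLcm j :=
  Finset.dvd_lcm (f := id) (Finset.mem_Icc.2 ⟨hs, hs'⟩)

theorem qLcm_ne_zero (j : ℕ) : qLcm j ≠ 0 := by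
  rw [qLcm, Ne, Finset.lcm_eq_zero_iff]
  rintro ⟨s, hs, rfl⟩
  exact absurd (Finset.mem_Icc.1 hs).1 (by norm_num)

theorem exists_not_isApproxDenominator {d j k : ℕ} {β : Fin d → ℝ}
    (hβ : (fun i => (β i : UnitAddCircle)) ∉ Omega d j k) :
    ∃ i, ¬IsApproxDenominator ((2 : ℝ) ^ ((j : ℤ) - k)) (β i) (qLcm j) := by
  contrapose! hβ
  choose l hl using hβ
  exact ⟨fun i => β i - l i / qLcm j, l, fun i => (hl i).le, fun i => by rw [sub_add_cancel]⟩

open scoped Classical in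
theorem sum_isApproxDenominator_qLcm_le {x : ℝ} {j k : ℕ} (hjk : 7 * j + 1 ≤ k)
    (hx : ¬IsApproxDenominator ((2 : ℝ) ^ ((j : ℤ) - k)) x (qLcm j)) (Q : ℕ) :
    ∑ q ∈ Finset.Icc 1 Q, (q : ℝ) ^ (-(3 / 2) : ℝ) *
      (if IsApproxDenominator ((2 : ℝ) ^ ((j : ℤ) - k)) x q then 1
        else (2 : ℝ) ^ (-(5 / 4 * j) : ℝ)) ≤ 3 * decaySum * (2 : ℝ) ^ (-(5 / 4 * j) : ℝ) := by
  set η : ℝ := (2 : ℝ) ^ ((j : ℤ) - k)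
  set δ : ℝ := (2 : ℝ) ^ (-(5 / 4 * j) : ℝ) with hδ
  have hη : 2 * η * ((8 ^ j : ℕ) : ℝ) ^ 2 ≤ 1 := by
    rw [← zpow_one_add₀ two_ne_zero, show ((8 ^ j : ℕ) : ℝ) = 2 ^ (3 * j) by
      rw [pow_mul]; norm_num, ← pow_mul, ← zpow_natCast, ← zpow_add₀ two_ne_zero]
    exact zpow_le_one_of_nonpos₀ one_le_two (by push_cast; omega)
  have happrox := sum_isApproxDenominator_le (pow_pos two_pos j) (pow_pos (by norm_num) j) hη
    (fun s hs hsP h => hx (h.of_dvd (qLcm_ne_zero j) (dvd_qLcm hs hsP))) Q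
  have hP : ((2 ^ j : ℕ) : ℝ) ^ (-(3 / 2) : ℝ) ≤ δ := by
    rw [Nat.cast_pow, Nat.cast_ofNat, ← Real.rpow_natCast, ← Real.rpow_mul zero_le_two]
    refine Real.rpow_le_rpow_of_exponent_le one_le_two ?_
    linarith [j.cast_nonneg (α := ℝ)]
  have hR : ((8 ^ j : ℕ) : ℝ) ^ (-(5 / 12) : ℝ) = δ := by
    rw [hδ, Nat.cast_pow, Nat.cast_ofNat, show (8 : ℝ) = 2 ^ (3 : ℝ) by norm_num,
      ← Real.rpow_natCast, ← Real.rpow_mul zero_le_two, ← Real.rpow_mul zero_le_two]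
    congr 1
    ring
  calc _ ≤ ∑ q ∈ Finset.Icc 1 Q, ((if IsApproxDenominator η x q then
        (q : ℝ) ^ (-(3 / 2) : ℝ) else 0) + (q : ℝ) ^ (-(3 / 2) : ℝ) * δ) := by
        refine Finset.sum_le_sum fun q _ => ?_
        split_ifs
        · rw [mul_one]
          exact le_add_of_nonneg_right (by positivity)
        · rw [zero_add]
    _ ≤ (δ + δ) * decaySum + decaySum * δ := by
        rw [Finset.sum_add_distrib, ← Finset.sum_filter, ← Finset.sum_mul]
        refine add_le_add (happrox.trans ?_) ?_
        · rw [hR]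
          exact mul_le_mul_of_nonneg_right (add_le_add_left hP δ) decaySum_nonneg
        · refine mul_le_mul_of_nonneg_right ?_ (by positivity)
          exact sum_rpow_le_decaySum fun q hq => (Finset.mem_Icc.1 hq).1
    _ = _ := by ring

end SmallDenominators

section WeightedTheta

variable {d : ℕ}

theorem norm_sq_torusTheta_le {q a : ℕ} {ε t D : ℝ} (hε : 0 < ε) (hq : 1 ≤ q)
    (ha : a ∈ numerators q) (harc : (q : ℝ) ^ 2 * ‖horocycle ε (t - a / q)‖ ^ 2 ≤ 8 * ε)
    (hD : 0 ≤ D) (β : Fin d → ℝ) (i : Fin d) (hβ : ∀ l : ℤ, D ≤ |β i - l / q|) :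
    ‖torusTheta (horocycle ε t) (fun i => (β i : UnitAddCircle))‖ ^ 2 ≤
      thetaConst ^ d * arcWeight d ε q (t - a / q) ^ 2 *
        Real.exp (-(π * (2 * ε / ‖horocycle ε (t - a / q)‖ ^ 2) * D ^ 2)) := by
  have hcop : IsCoprime (a : ℤ) (q : ℤ) :=
    (Nat.isCoprime_iff_coprime.2 (Finset.mem_filter.1 ha).2).symm
  have hshift : horocycle ε t = 2 * (a : ℤ) / q + horocycle ε (t - a / q) := by
    simp only [horocycle]
    push_cast
    ring
  have him := horocycle_im ε (t - a / q)
  generalize hτ : horocycle ε (t - a / q) = τ at *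
  have htheta (x : ℝ) {D : ℝ} (hD : 0 ≤ D) (hx : ∀ l : ℤ, D ≤ |x - l / q|) :
      ‖jacobiTheta₂ x (horocycle ε t)‖ ^ 2 ≤
        thetaConst * (q * ‖τ‖)⁻¹ * Real.exp (-(π * (2 * ε / ‖τ‖ ^ 2) * D ^ 2)) := by
    rw [hshift, ← him]
    exact norm_sq_jacobiTheta₂_le hq hcop (by linarith) (by linarith) hD hx
  have hcoord (l : Fin d) : ‖jacobiTheta₂ (β l) (horocycle ε t)‖ ^ 2 ≤ thetaConst * (q * ‖τ‖)⁻¹ *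
      if l = i then Real.exp (-(π * (2 * ε / ‖τ‖ ^ 2) * D ^ 2)) else 1 := by
    split_ifs with hl
    · exact hl ▸ htheta (β i) hD hβ
    · simpa using htheta (β l) le_rfl fun _ => abs_nonneg _
  rw [torusTheta_coe (by rw [horocycle_im]; linarith), norm_prod, ← Finset.prod_pow]
  refine (Finset.prod_le_prod (fun _ _ => by positivity) fun l _ => hcoord l).trans_eq ?_
  rw [Finset.prod_mul_distrib, Finset.prod_const, Finset.card_univ, Fintype.card_fin, mul_pow,
    Finset.prod_ite_eq' Finset.univ i, if_pos (Finset.mem_univ i), arcWeight_sq, hτ]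

/-- The weight of the Cauchy–Schwarz inequality in `t`: the expected size of the theta function of
`ℤ^d` on the horocycle of height `ε`, summed over the Farey fractions of order `Q`. -/
def fareyWeight (d : ℕ) (ε : ℝ) (Q : ℕ) : ℝ → ℝ≥0∞ :=
  fareySum Q fun q s => ENNReal.ofReal (arcWeight d ε q s)

theorem measurable_fareyWeight (d : ℕ) (ε : ℝ) (Q : ℕ) : Measurable (fareyWeight d ε Q) := by
  have := measurable_arcWeight d ε
  unfold fareyWeight fareySum
  fun_prop

theorem fareyWeight_ne_top (d : ℕ) (ε : ℝ) (Q : ℕ) (t : ℝ) : fareyWeight d ε Q t ≠ ∞ := by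
  simp only [fareyWeight, fareySum, ne_eq, ENNReal.sum_eq_top, ENNReal.ofReal_ne_top, and_false,
    exists_false, not_false_eq_true]

theorem fareyWeight_ne_zero {ε t : ℝ} {Q : ℕ} (d : ℕ) (hε : 0 < ε) (hQ : 0 < Q)
    (ht : t ∈ Set.Icc (0 : ℝ) 1) : fareyWeight d ε Q t ≠ 0 := by
  obtain ⟨q, hq, a, ha, -⟩ := exists_farey_arc hQ ht
  refine (lt_of_lt_of_le ?_ (le_fareySum hq ha _ t)).ne'
  exact ENNReal.ofReal_pos.2 (arcWeight_pos d hε (Finset.mem_Icc.1 hq).1 _)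

theorem lintegral_fareyWeight_le (hd : 5 ≤ d) {ε : ℝ} (hε : 0 < ε) (Q : ℕ) :
    ∫⁻ t in Set.Ioc (0 : ℝ) 1, fareyWeight d ε Q t ≤
      ENNReal.ofReal (2 * (decayIntegral * ε ^ (1 - (d : ℝ) / 2)) * decaySum) := by
  have hJ := decayIntegral_nonneg
  have hK : 0 ≤ decayIntegral * ε ^ (1 - (d : ℝ) / 2) := by positivity
  refine (setLIntegral_le_lintegral _ _).trans ((lintegral_fareySum_ofReal_le Q
    (measurable_arcWeight d ε) hK (M := 1) (fun _ => zero_le_one) fun q hq => ?_).trans ?_)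
  · rw [Pi.one_apply, mul_one]
    exact lintegral_arcWeight_le hd (Finset.mem_Icc.1 hq).1 hε
  · simp_rw [Pi.one_apply, mul_one]
    gcongr
    exact sum_rpow_le_decaySum fun q hq => (Finset.mem_Icc.1 hq).1

theorem sq_mul_norm_horocycle_le {q Q : ℕ} {ε s : ℝ} (hε : ε * Q ^ 2 = 1)
    (hq : q ∈ Finset.Icc 1 Q) (hs : |s| ≤ 1 / (q * Q)) :
    (q : ℝ) ^ 2 * ‖horocycle ε s‖ ^ 2 ≤ 8 * ε := by
  obtain ⟨hq1, hqQ⟩ := Finset.mem_Icc.1 hq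
  have hQ0 : (0 : ℝ) < Q := by exact_mod_cast hq1.trans hqQ
  have hheight : (q : ℝ) ^ 2 * ε ^ 2 ≤ ε := by
    calc (q : ℝ) ^ 2 * ε ^ 2 ≤ (Q : ℝ) ^ 2 * ε ^ 2 := by gcongr
      _ = ε * (ε * Q ^ 2) := by ring
      _ = ε := by rw [hε, mul_one]
  have hwidth : (q : ℝ) ^ 2 * s ^ 2 ≤ ε := by
    calc (q : ℝ) ^ 2 * s ^ 2 = ((q : ℝ) * |s|) ^ 2 := by rw [mul_pow, sq_abs]
      _ ≤ ((q : ℝ) * (1 / (q * Q))) ^ 2 := by gcongr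
      _ = 1 / (Q : ℝ) ^ 2 := by field_simp
      _ = ε := by rw [← hε, mul_div_cancel_right₀ _ (by positivity)]
  rw [norm_sq_horocycle]
  linarith

theorem inv_fareyWeight_mul_torusTheta_le {Q : ℕ} {ε t : ℝ} {β : Fin d → ℝ} {i : Fin d}
    {D : ℕ → ℝ} (hε : ε * Q ^ 2 = 1) (hD : ∀ q, 0 ≤ D q)
    (hβ : ∀ (q : ℕ) (l : ℤ), D q ≤ |β i - l / q|) (ht : t ∈ Set.Icc (0 : ℝ) 1) :
    (fareyWeight d ε Q t)⁻¹ *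
        ‖torusTheta (horocycle ε t) (fun i => (β i : UnitAddCircle))‖ₑ ^ 2 ≤
      fareySum Q (fun q s => ENNReal.ofReal (thetaConst ^ d * (arcWeight d ε q s *
        Real.exp (-(π * (2 * ε / ‖horocycle ε s‖ ^ 2) * D q ^ 2))))) t := by
  have hQ : 0 < Q := Nat.pos_of_ne_zero fun h => by simp [h] at hε
  have hε0 : 0 < ε := pos_of_mul_pos_left (hε ▸ one_pos) (sq_nonneg _)
  obtain ⟨q, hq, a, ha, hta⟩ := exists_farey_arc hQ ht
  have hq1 := (Finset.mem_Icc.1 hq).1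
  have hw := arcWeight_pos d hε0 hq1 (t - a / q)
  refine le_trans ?_ (le_fareySum hq ha _ t)
  calc (fareyWeight d ε Q t)⁻¹ *
        ‖torusTheta (horocycle ε t) (fun i => (β i : UnitAddCircle))‖ₑ ^ 2
      ≤ (ENNReal.ofReal (arcWeight d ε q (t - a / q)))⁻¹ * ENNReal.ofReal
          (thetaConst ^ d * arcWeight d ε q (t - a / q) ^ 2 *
            Real.exp (-(π * (2 * ε / ‖horocycle ε (t - a / q)‖ ^ 2) * D q ^ 2))) := by
        gcongr
        · exact le_fareySum hq ha (fun q s => ENNReal.ofReal (arcWeight d ε q s)) t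
        · rw [← ofReal_norm, ← ENNReal.ofReal_pow (norm_nonneg _)]
          exact ENNReal.ofReal_le_ofReal (norm_sq_torusTheta_le hε0 hq1 ha
            (sq_mul_norm_horocycle_le hε hq hta) (hD q) β i (hβ q))
    _ = _ := by
        rw [← ENNReal.ofReal_inv_of_pos hw, ← ENNReal.ofReal_mul (by positivity)]
        congr 1
        field_simp

open scoped Classical in
theorem lintegral_inv_fareyWeight_mul_torusTheta_le (hd : 5 ≤ d) {Q : ℕ} {ε η Y : ℝ}
    (hε : ε * Q ^ 2 = 1) (hη : 0 ≤ η) (hY : 0 < Y) (hηY : η ^ 2 = ε * Y) (β : Fin d → ℝ)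
    (i : Fin d) :
    ∫⁻ t in Set.Ioc (0 : ℝ) 1, (fareyWeight d ε Q t)⁻¹ *
        ‖torusTheta (horocycle ε t) (fun i => (β i : UnitAddCircle))‖ₑ ^ 2 ≤
      ENNReal.ofReal (2 * (thetaConst ^ d * (decayIntegral * ε ^ (1 - (d : ℝ) / 2))) *
        ∑ q ∈ Finset.Icc 1 Q, (q : ℝ) ^ (-(3 / 2) : ℝ) *
          if IsApproxDenominator η (β i) q then 1 else Y ^ (-(5 / 8) : ℝ)) := by
  have hε0 : 0 < ε := pos_of_mul_pos_left (hε ▸ one_pos) (sq_nonneg _)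
  have hC := thetaConst_pos
  have hJ := decayIntegral_nonneg
  let D (q : ℕ) : ℝ := if IsApproxDenominator η (β i) q then 0 else η
  have hD (q : ℕ) : 0 ≤ D q := by
    simp only [D]
    split_ifs
    exacts [le_rfl, hη]
  have hβ (q : ℕ) (l : ℤ) : D q ≤ |β i - l / q| := by
    simp only [D]
    split_ifs with h
    · exact abs_nonneg _
    · exact not_lt.1 fun hl => h ⟨l, hl⟩
  refine (setLIntegral_mono' measurableSet_Ioc fun t ht =>
    inv_fareyWeight_mul_torusTheta_le hε hD hβ (Set.Ioc_subset_Icc_self ht)).trans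
    ((setLIntegral_le_lintegral _ _).trans (lintegral_fareySum_ofReal_le Q (fun q => ?_)
      (by positivity) (fun q => by split_ifs <;> positivity) fun q hq => ?_))
  · have := measurable_arcWeight d ε q
    have := (continuous_horocycle ε).measurable
    fun_prop
  have hq1 := (Finset.mem_Icc.1 hq).1
  simp_rw [ENNReal.ofReal_mul (by positivity : 0 ≤ thetaConst ^ d)]
  rw [lintegral_const_mul' _ _ ENNReal.ofReal_ne_top, mul_assoc, mul_assoc,
    ENNReal.ofReal_mul (by positivity), ← mul_assoc (decayIntegral * _)]
  gcongr 1
  simp only [D]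
  split_ifs
  · simpa using lintegral_arcWeight_le hd hq1 hε0
  · rw [hηY]
    exact lintegral_arcWeight_mul_exp_le hd hq1 hε0 hY

theorem lintegral_inv_fareyWeight_mul_torusTheta_le_of_notMem_Omega (hd : 5 ≤ d) {j k : ℕ}
    (hjk : 7 * j + 1 ≤ k) {ε : ℝ} (hε : ε * ((2 ^ k : ℕ) : ℝ) ^ 2 = 1)
    {α : UnitAddTorus (Fin d)} (hα : α ∉ Omega d j k) :
    ∫⁻ t in Set.Ioc (0 : ℝ) 1, (fareyWeight d ε (2 ^ k) t)⁻¹ *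
        ‖torusTheta (horocycle ε t) α‖ₑ ^ 2 ≤
      ENNReal.ofReal (2 * (thetaConst ^ d * (decayIntegral * ε ^ (1 - (d : ℝ) / 2))) *
        (3 * decaySum * (2 : ℝ) ^ (-(5 / 4 * j) : ℝ))) := by
  classical
  have hε0 : 0 < ε := pos_of_mul_pos_left (hε ▸ one_pos) (sq_nonneg _)
  have hC := thetaConst_pos
  have hJ := decayIntegral_nonneg
  obtain ⟨β, rfl⟩ : ∃ β : Fin d → ℝ, (fun i => (β i : UnitAddCircle)) = α := by
    choose β hβ using fun i => QuotientAddGroup.mk_surjective (α i)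
    exact ⟨β, funext hβ⟩
  obtain ⟨i, hi⟩ := exists_not_isApproxDenominator hα
  have hη : ((2 : ℝ) ^ ((j : ℤ) - k)) ^ 2 = ε * (2 : ℝ) ^ (2 * j) := by
    rw [eq_one_div_of_mul_eq_one_left hε, zpow_sub₀ two_ne_zero]
    push_cast
    simp only [zpow_natCast]
    ring
  have hY : ((2 : ℝ) ^ (2 * j)) ^ (-(5 / 8) : ℝ) = 2 ^ (-(5 / 4 * j) : ℝ) := by
    rw [← Real.rpow_natCast, ← Real.rpow_mul zero_le_two]
    congr 1
    push_cast
    ring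
  refine (lintegral_inv_fareyWeight_mul_torusTheta_le hd hε (by positivity) (by positivity) hη β
    i).trans ?_
  rw [hY]
  gcongr
  exact sum_isApproxDenominator_qLcm_le hjk hi _

end WeightedTheta

section Maximal

variable {d : ℕ}

theorem dyadicMaximal_le (hd : 5 ≤ d) {c : ℝ} (hc : 0 < c)
    (hcard : ∀ N : ℕ, 1 ≤ N → c * (N : ℝ) ^ ((d : ℝ) / 2 - 1) ≤ (sphere d √N).card)
    {k : ℕ} {ε : ℝ} (hε : ε * ((2 ^ k : ℕ) : ℝ) ^ 2 = 1)
    (f : lp (fun _ : Fin d → ℤ => ℂ) 2) (n : Fin d → ℤ) :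
    dyadicMaximal k (fun n => f n) n ≤
      ENNReal.ofReal (Real.exp (8 * π) / (c * ε ^ (1 - (d : ℝ) / 2))) *
        ∫⁻ t in Set.Ioc (0 : ℝ) 1, ‖gaussConv (horocycle ε t) f n‖ₑ := by
  have hε0 : 0 < ε := pos_of_mul_pos_left (hε ▸ one_pos) (sq_nonneg _)
  have hd' : (5 : ℝ) ≤ d := by exact_mod_cast hd
  push_cast at hε
  refine iSup₂_le fun lam ⟨hlow, hup, N, hN⟩ => ?_
  have hlam0 : 0 ≤ lam := (pow_nonneg zero_le_two k).trans hlow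
  have hlam : lam = √N := by rw [← hN, Real.sqrt_sq hlam0]
  have hεN : 1 ≤ ε * N := by
    rw [← hε, ← hN]
    gcongr
  have hεN' : ε * N ≤ 4 := by
    calc ε * N ≤ ε * (2 ^ (k + 1)) ^ 2 := by rw [← hN]; gcongr
      _ = 4 * (ε * (2 ^ k) ^ 2) := by ring
      _ = 4 := by rw [hε, mul_one]
  have hN1 : 1 ≤ N := Nat.one_le_iff_ne_zero.2 fun h => by norm_num [h] at hεN
  have hnorm : ‖((sphere d lam).card : ℂ)⁻¹‖ₑ ≤
      ENNReal.ofReal (c * ε ^ (1 - (d : ℝ) / 2))⁻¹ := by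
    rw [← ofReal_norm, norm_inv, Complex.norm_natCast]
    refine ENNReal.ofReal_le_ofReal (inv_anti₀ (by positivity) (le_trans ?_ (hlam ▸ hcard N hN1)))
    rw [← neg_sub ((d : ℝ) / 2), Real.rpow_neg hε0.le, ← Real.inv_rpow hε0.le]
    gcongr
    · linarith
    · rwa [inv_le_iff_one_le_mul₀' hε0]
  have hexp : Real.exp (2 * π * ε * N) ≤ Real.exp (8 * π) :=
    Real.exp_le_exp.2 (by nlinarith [Real.pi_pos])
  rw [sphericalAverage, enorm_mul, div_eq_inv_mul, ENNReal.ofReal_mul (by positivity), mul_assoc]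
  gcongr
  exact (hlam ▸ enorm_sum_sphere_le hε0 f n N).trans (by gcongr)

theorem exists_tsum_sq_dyadicMaximal_le (hd : 5 ≤ d) :
    ∃ K : ℝ, 0 ≤ K ∧ ∀ k j : ℕ, 7 * j + 1 ≤ k → ∀ f : lp (fun _ : Fin d → ℤ => ℂ) 2,
      (∀ᵐ α ∂torusMeasure d, α ∈ Omega d j k → fourierTransform f α = 0) →
      ∑' n, dyadicMaximal k (fun n => f n) n ^ 2 ≤
        ENNReal.ofReal (K * (2 : ℝ) ^ (-(5 / 4 * j) : ℝ)) * ∑' n, ‖f n‖ₑ ^ 2 := by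
  obtain ⟨c, hc, hcard⟩ := card_sphere_ge d hd
  have hC := thetaConst_pos
  have hJ := decayIntegral_nonneg
  have hZ := decaySum_nonneg
  refine ⟨(Real.exp (8 * π) / c) ^ 2 * (12 * thetaConst ^ d * decayIntegral ^ 2 * decaySum ^ 2),
    by positivity, fun k j hjk f hf => ?_⟩
  obtain ⟨ε, hε⟩ : ∃ ε : ℝ, ε * ((2 ^ k : ℕ) : ℝ) ^ 2 = 1 := ⟨_, inv_mul_cancel₀ (by positivity)⟩
  have hε0 : 0 < ε := pos_of_mul_pos_left (hε ▸ one_pos) (sq_nonneg _)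
  have hconv := tsum_sq_lintegral_gaussConv_le hε0 f (measurable_fareyWeight d ε (2 ^ k))
    (fun t ht => fareyWeight_ne_zero d hε0 (Nat.two_pow_pos k) (Set.Ioc_subset_Icc_self ht))
    (fareyWeight_ne_top d ε (2 ^ k)) (hf.mono fun α hα hne =>
      lintegral_inv_fareyWeight_mul_torusTheta_le_of_notMem_Omega hd hjk hε fun h => hne (hα h))
  calc ∑' n, dyadicMaximal k (fun n => f n) n ^ 2
      ≤ ∑' n, ENNReal.ofReal (Real.exp (8 * π) / (c * ε ^ (1 - (d : ℝ) / 2))) ^ 2 *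
          (∫⁻ t in Set.Ioc (0 : ℝ) 1, ‖gaussConv (horocycle ε t) f n‖ₑ) ^ 2 := by
        gcongr with n
        rw [← mul_pow]
        gcongr
        exact dyadicMaximal_le hd hc hcard hε f n
    _ ≤ ENNReal.ofReal (Real.exp (8 * π) / (c * ε ^ (1 - (d : ℝ) / 2))) ^ 2 *
          (ENNReal.ofReal (2 * (decayIntegral * ε ^ (1 - (d : ℝ) / 2)) * decaySum) *
            (ENNReal.ofReal (2 * (thetaConst ^ d * (decayIntegral * ε ^ (1 - (d : ℝ) / 2))) *
              (3 * decaySum * (2 : ℝ) ^ (-(5 / 4 * j) : ℝ))) * ∑' n, ‖f n‖ₑ ^ 2)) := by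
        rw [ENNReal.tsum_mul_left]
        gcongr
        exact hconv.trans (mul_le_mul_left (lintegral_fareyWeight_le hd hε0 (2 ^ k)) _)
    _ = _ := by
        rw [← mul_assoc, ← mul_assoc, ← ENNReal.ofReal_pow (by positivity),
          ← ENNReal.ofReal_mul (by positivity), ← ENNReal.ofReal_mul (by positivity)]
        congr 2
        field_simp
        ring

theorem l2Norm_le_of_tsum_sq_le {g h : (Fin d → ℤ) → ℝ≥0∞} {A : ℝ} (hA : 0 ≤ A)
    (hgh : ∑' n, g n ^ 2 ≤ ENNReal.ofReal A * ∑' n, h n ^ 2) :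
    l2Norm g ≤ ENNReal.ofReal √A * l2Norm h := by
  refine (ENNReal.rpow_le_rpow hgh (by norm_num : (0 : ℝ) ≤ 1 / 2)).trans_eq ?_
  rw [ENNReal.mul_rpow_of_nonneg _ _ (by norm_num), ENNReal.ofReal_rpow_of_nonneg hA (by norm_num),
    ← Real.sqrt_eq_rpow, l2Norm]

theorem seven_mul_add_one_le_two_pow {j : ℕ} (hj : 1 ≤ j) : 7 * j + 1 ≤ 2 ^ (j + 2) := by
  induction j, hj using Nat.le_induction with
  | base => norm_num
  | succ j hj ih => rw [add_right_comm, pow_succ]; omega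

theorem two_pow_add_two_le {j k : ℕ} (hj : 1 ≤ j) (h : (j : ℝ) ≤ Real.logb 2 k - 2) :
    2 ^ (j + 2) ≤ k := by
  have hk : k ≠ 0 := by
    rintro rfl
    have : (1 : ℝ) ≤ j := by exact_mod_cast hj
    rw [Nat.cast_zero, Real.logb_zero] at h
    linarith
  rw [le_sub_iff_add_le, Real.le_logb_iff_rpow_le one_lt_two (by positivity)] at h
  exact_mod_cast h

theorem rpow_neg_le_mul_inv {j : ℕ} (hj : 1 ≤ j) :
    (2 : ℝ) ^ (-(5 / 8 * j) : ℝ) ≤ 16 * (2 : ℝ) ^ (-(j : ℝ) / 2) * (j : ℝ)⁻¹ := by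
  have hj0 : (0 : ℝ) < j := by exact_mod_cast hj
  have hlin : (j : ℝ) ≤ 16 * (2 : ℝ) ^ ((j : ℝ) / 8) := by
    rw [Real.rpow_def_of_pos two_pos]
    nlinarith [Real.add_one_le_exp (Real.log 2 * ((j : ℝ) / 8)), Real.log_two_gt_d9]
  rw [le_mul_inv_iff₀ hj0]
  calc (2 : ℝ) ^ (-(5 / 8 * j) : ℝ) * j
      ≤ (2 : ℝ) ^ (-(5 / 8 * j) : ℝ) * (16 * (2 : ℝ) ^ ((j : ℝ) / 8)) := by gcongr
    _ = 16 * (2 : ℝ) ^ (-(5 / 8 * j) + (j : ℝ) / 8 : ℝ) := by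
        rw [Real.rpow_add two_pos]
        ring
    _ = _ := by
        congr 2
        ring

end Maximal

end DiscreteSpherical

end

theorem proposition2p1_general (d : ℕ) (hd : 5 ≤ d) :
    ∃ C : ℝ, 0 < C ∧ ∀ k j : ℕ, 7 * j + 1 ≤ k →
      ∀ f : lp (fun _ : Fin d → ℤ => ℂ) 2,
        (∀ᵐ α ∂(DiscreteSpherical.torusMeasure d),
          α ∈ DiscreteSpherical.Omega d j k → DiscreteSpherical.fourierTransform f α = 0) →
        DiscreteSpherical.l2Norm (DiscreteSpherical.dyadicMaximal k (fun n => f n)) ≤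
          ENNReal.ofReal (C * (2 : ℝ) ^ (-(5 / 8 * j) : ℝ)) *
            DiscreteSpherical.l2Norm (fun n => ‖f n‖ₑ) := by
  obtain ⟨K, hK, hle⟩ := DiscreteSpherical.exists_tsum_sq_dyadicMaximal_le hd
  refine ⟨√K + 1, by positivity, fun k j hjk f hf =>
    (DiscreteSpherical.l2Norm_le_of_tsum_sq_le (by positivity) (hle k j hjk f hf)).trans ?_⟩
  gcongr
  rw [Real.sqrt_mul hK, Real.sqrt_eq_rpow ((2 : ℝ) ^ _), ← Real.rpow_mul zero_le_two,
    show -(5 / 4 * j : ℝ) * (1 / 2) = -(5 / 8 * j) by ring]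
  gcongr
  linarith

theorem proposition2p1 (d : ℕ) (hd : 5 ≤ d) :
    ∃ C : ℝ, 0 < C ∧ ∀ k j : ℕ, 1 ≤ j → (j : ℝ) ≤ Real.logb 2 (k : ℝ) - 2 →
      ∀ f : lp (fun _ : Fin d → ℤ => ℂ) 2,
        (∀ᵐ α ∂(DiscreteSpherical.torusMeasure d),
          α ∈ DiscreteSpherical.Omega d j k → DiscreteSpherical.fourierTransform f α = 0) →
        DiscreteSpherical.l2Norm (DiscreteSpherical.dyadicMaximal k (fun n => f n)) ≤
          ENNReal.ofReal (C * (2 : ℝ) ^ (-(j : ℝ) / 2) * (j : ℝ)⁻¹) *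
            DiscreteSpherical.l2Norm (fun n => ‖f n‖ₑ) := by
  obtain ⟨C, hC, hmax⟩ := proposition2p1_general d hd
  refine ⟨C * 16, by positivity, fun k j hj hjk f hf => (hmax k j
    ((DiscreteSpherical.seven_mul_add_one_le_two_pow hj).trans
      (DiscreteSpherical.two_pow_add_two_le hj hjk)) f hf).trans ?_⟩
  rw [mul_assoc, mul_assoc, ← mul_assoc 16]
  gcongr
  exact DiscreteSpherical.rpow_neg_le_mul_inv hj
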